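/- **Conventions.** A *trivalent graph* is a finite multigraph (loops and multiple edges allowed) in which exactly three half-edges emanate from each vertex; it is *oriented* if each vertex carries a cyclic ordering of the three half-edges at it. It is *connected* if it is non-empty and any two vertices are joined by a path, and *2-connected* if it is connected and remains connected after deletion of any single edge. Let $L$ be a finite-dimensional Lie algebra over a field, with an ad-invariant symmetric non-degenerate bilinear form $\langle\cdot,\cdot\rangle$. Choose a basis $(L_a)$ of $L$; put $f_{abc}=\langle L_a,[L_b,L_c]\rangle$, $t_{ab}=\langle L_a,L_b\rangle$, and let $(t^{ab})$ be the inverse of the matrix $(t_{ab})$. For an oriented trivalent graph $G$, $W_L(G)$ is the sum, over all labellings of the half-edges of $G$ by basis indices, of the product over the vertices of $f_{abc}$ (where $a,b,c$ are the labels around the vertex, in cyclic order) times the product over the edges of $t^{aa'}$ (where $a,a'$ are the labels of the two halves of the edge). For $sl(N)$ over a field $K$ of characteristic $0$ the form is $\langle x,y\rangle=\operatorname{tr}(xy)$. An *oriented sphere* with a cell decomposition is obtained from finitely many oriented polygons by gluing their sides in pairs, reversing the direction of the boundary; it is a sphere when it is connected and its Euler characteristic (vertices $-$ edges $+$ faces)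 is $2$. An *embedding* of a connected trivalent graph $G$ in an oriented sphere is an identification of $G$ (its vertices, edges and half-edges) with the graph of vertices and edges of such a cell decomposition. Two embeddings are counted as the same if there is an orientation-preserving isomorphism of the decomposed spheres that carries the one identification to the other. **Proposition 1.3.** Let $G$ be a connected oriented trivalent graph with $v$ vertices and let $K$ be a field of characteristic $0$. There is a unique polynomial $P\in\mathbb Z[X]$ such that $W_{sl(N)}(G)=P(N)$ for all $N\ge 1$, for every choice of basis of $sl(N)$ over $K$. Its degree is at most $\frac v2+2$. Let $W^{\mathrm{top}}_{sl(N)}(G)$ be the coefficient of $X^{\frac v2+2}$ in $P$. - If $G$ is 2-connected, then $|W^{\mathrm{top}}_{sl(N)}(G)|$ equals the number of embeddings of $G$ in an oriented sphere (in particular this number is finite). - If $G$ is not 2-connected, then $W^{\mathrm{top}}_{sl(N)}(G)=0$. -/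

import Mathlib

open scoped Polynomial

/-- A finite trivalent multigraph (multiple edges and loops allowed) with vertex set `V` and set of
half-edges `H`.  The half-edge `h` emanates from the vertex `vert h`; its edge is `{h, flip h}`. -/
structure TrivalentGraph (V H : Type*) where
  vert : H → V
  flip : Equiv.Perm H
  flip_flip : ∀ h, flip (flip h) = h
  flip_ne : ∀ h, flip h ≠ h
  card_fiber : ∀ v, Nat.card {h : H // vert h = v} = 3

/-- An oriented trivalent graph: every vertex carries a cyclic ordering of the (three) half-edges
emanating from it, encoded by the permutation `next` whose cycles are exactly the sets of half-edges
at the vertices. -/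
structure OrientedTrivalentGraph (V H : Type*) extends TrivalentGraph V H where
  next : Equiv.Perm H
  sameCycle_next : ∀ h h', next.SameCycle h h' ↔ vert h = vert h'

/-- The set of cycles (fixed points included) of a permutation. -/
abbrev PermCycles {D : Type*} (p : Equiv.Perm D) : Type _ :=
  Quotient (Equiv.Perm.SameCycle.setoid p)

namespace TrivalentGraph

variable {V H : Type*} (G : TrivalentGraph V H)

/-- Adjacency of distinct vertices through the edges of `G` none of whose halves lies in `S`
(the deleted half-edges).  It is only used to speak about connectedness. -/
def graphDeleting (S : Set H) : SimpleGraph V :=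
  SimpleGraph.fromRel fun v w => ∃ h, h ∉ S ∧ G.flip h ∉ S ∧ G.vert h = v ∧ G.vert (G.flip h) = w

/-- `G` is connected (in particular non-empty). -/
def Connected : Prop := (G.graphDeleting ∅).Connected

/-- `G` is connected, and stays connected when any single edge is deleted. -/
def TwoConnected : Prop :=
  G.Connected ∧ ∀ h, (G.graphDeleting {h, G.flip h}).Connected

/-- The set of edges. -/
abbrev Edge : Type _ := PermCycles G.flip

theorem vert_surjective : Function.Surjective G.vert := by
  intro v
  have : Nat.card {h : H // G.vert h = v} ≠ 0 := by rw [G.card_fiber v]; norm_num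
  obtain ⟨⟨h, hh⟩⟩ := (Nat.card_ne_zero.mp this).1
  exact ⟨h, hh⟩

/-- Some half-edge at the vertex `v`. -/
noncomputable def halfAt (v : V) : H := Function.surjInv G.vert_surjective v

end TrivalentGraph

section Weight

variable {K L ι : Type*} [Field K] [LieRing L] [LieAlgebra K L]

/-- The structure constants `f i j k = ⟨L i, [L j, L k]⟩` in the basis `b`. -/
noncomputable def structureConst (B : LinearMap.BilinForm K L) (b : Module.Basis ι K L) (i j k : ι) : K :=
  B (b i) ⁅b j, b k⁆

open Classical in
/-- The inverse of the matrix of the metric `B` in the basis `b`. -/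
noncomputable def inverseMetric [Fintype ι] (B : LinearMap.BilinForm K L)
    (b : Module.Basis ι K L) : Matrix ι ι K :=
  (Matrix.of fun i j => B (b i) (b j))⁻¹

/-- The factor of `W_L(G)` contributed by a vertex, read off from the half-edge `h` on, for the
labelling `a` of the half-edges. -/
noncomputable def vertexFactor {V H : Type*} (B : LinearMap.BilinForm K L) (b : Module.Basis ι K L)
    (G : OrientedTrivalentGraph V H) (a : H → ι) (h : H) : K :=
  structureConst B b (a h) (a (G.next h)) (a (G.next (G.next h)))

/-- The factor of `W_L(G)` contributed by the edge `{h, flip h}`. -/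
noncomputable def edgeFactor {V H : Type*} [Fintype ι] (B : LinearMap.BilinForm K L)
    (b : Module.Basis ι K L) (G : OrientedTrivalentGraph V H) (a : H → ι) (h : H) : K :=
  inverseMetric B b (a h) (a (G.flip h))

open Classical in
/-- `W_L(G)`, computed in the basis `b` of the Lie algebra `L` with metric `B`: the sum over all
labellings of the half-edges by basis elements of the product of the structure constants around the
vertices and of the entries of the inverse metric along the edges.  The half-edges at which one
starts reading at the vertices and edges are chosen arbitrarily; see `vertexFactor_eq` and
`edgeFactor_flip` for the independence of these choices. -/
noncomputable def lieWeight {V H : Type*} [Fintype V] [Fintype H] [Fintype ι]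
    (B : LinearMap.BilinForm K L) (b : Module.Basis ι K L) (G : OrientedTrivalentGraph V H) : K :=
  ∑ a : H → ι, (∏ v : V, vertexFactor B b G a (G.halfAt v)) *
    ∏ e : G.Edge, edgeFactor B b G a e.out

theorem vertexFactor_next {V H : Type*} (B : LinearMap.BilinForm K L)
    (hs : ∀ x y, B x y = B y x) (hinv : ∀ x y z, B ⁅x, y⁆ z = B x ⁅y, z⁆)
    (b : Module.Basis ι K L) (G : OrientedTrivalentGraph V H) (a : H → ι) (h : H) :
    vertexFactor B b G a (G.next h) = vertexFactor B b G a h := by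
  have h3 : G.next (G.next (G.next h)) = h := by
    classical
    have hc : Nat.card {x // G.vert x = G.vert h} = 3 := G.card_fiber _
    have hv : ∀ x, G.vert (G.next x) = G.vert x := fun x =>
      ((G.sameCycle_next x (G.next x)).1 ((Equiv.Perm.sameCycle_apply_right).2
        (Equiv.Perm.SameCycle.refl _ _))).symm
    have : Finite {x // G.vert x = G.vert h} := Nat.finite_of_card_ne_zero (by omega)
    have : Fintype {x // G.vert x = G.vert h} := Fintype.ofFinite _
    let p : Equiv.Perm {x // G.vert x = G.vert h} :=
      G.next.subtypePerm (fun x => by rw [hv])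
    have hcyc : p.IsCycleOn (Set.univ : Set {x // G.vert x = G.vert h}) := by
      refine ⟨Set.bijOn_univ.2 p.bijective, fun x _ y _ => ?_⟩
      have := (G.sameCycle_next x.1 y.1).2 (x.2.trans y.2.symm)
      exact Equiv.Perm.sameCycle_subtypePerm.2 this
    have hcard : (Finset.univ : Finset {x // G.vert x = G.vert h}).card = 3 := by
      rw [Finset.card_univ, ← Nat.card_eq_fintype_card, hc]
    have hp := Equiv.Perm.IsCycleOn.pow_card_apply (s := Finset.univ) (f := p)
      (by simpa using hcyc) (Finset.mem_univ ⟨h, rfl⟩)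
    rw [hcard] at hp
    exact congrArg Subtype.val hp
  unfold vertexFactor structureConst
  rw [h3, ← hinv, hs]

/-- The factor of a vertex does not depend on the half-edge at which one starts reading. -/
theorem vertexFactor_eq {V H : Type*} [Finite H] (B : LinearMap.BilinForm K L)
    (hs : ∀ x y, B x y = B y x) (hinv : ∀ x y z, B ⁅x, y⁆ z = B x ⁅y, z⁆)
    (b : Module.Basis ι K L) (G : OrientedTrivalentGraph V H) (a : H → ι) {h h' : H}
    (hh : G.vert h = G.vert h') : vertexFactor B b G a h = vertexFactor B b G a h' := by
  obtain ⟨n, -, -, rfl⟩ := ((G.sameCycle_next h h').2 hh).exists_pow_eq'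
  clear hh
  induction n with
  | zero => rfl
  | succ n ih => rw [ih, pow_succ', Equiv.Perm.mul_apply, vertexFactor_next B hs hinv]

/-- The factor of an edge does not depend on the half-edge at which one starts reading. -/
theorem edgeFactor_flip {V H : Type*} [Fintype ι] (B : LinearMap.BilinForm K L)
    (hs : ∀ x y, B x y = B y x) (b : Module.Basis ι K L) (G : OrientedTrivalentGraph V H)
    (a : H → ι) (h : H) : edgeFactor B b G a (G.flip h) = edgeFactor B b G a h := by
  classical
  have ht : (inverseMetric B b).transpose = inverseMetric B b := by
    unfold inverseMetric
    rw [Matrix.transpose_nonsing_inv]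
    congr 1
    ext i j
    exact hs _ _
  unfold edgeFactor
  rw [G.flip_flip]
  exact congrFun (congrFun ht (a h)) (a (G.flip h))

end Weight

/-- The metric `⟨x, y⟩ = tr (x y)` on `sl(N)`. -/
def slTraceForm (K : Type*) [Field K] (N : ℕ) :
    LinearMap.BilinForm K (LieAlgebra.SpecialLinear.sl (Fin N) K) :=
  LinearMap.mk₂ K
    (fun x y => Matrix.trace ((x : Matrix (Fin N) (Fin N) K) * (y : Matrix (Fin N) (Fin N) K)))
    (fun x y z => by simp [add_mul]) (fun c x y => by simp)
    (fun x y z => by simp [mul_add]) (fun c x y => by simp)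

/-- The polynomial `P` gives `W_{sl(N)}(G)` for all `N ≥ 1` (in every basis of `sl(N)`). -/
def IsSlPolynomial (K : Type*) [Field K] {V H : Type*} [Fintype V] [Fintype H]
    (G : OrientedTrivalentGraph V H) (P : ℤ[X]) : Prop :=
  ∀ N : ℕ, 1 ≤ N → ∀ (ι : Type) [Fintype ι]
    (b : Module.Basis ι K (LieAlgebra.SpecialLinear.sl (Fin N) K)),
    lieWeight (slTraceForm K N) b G = ((P.eval (N : ℤ) : ℤ) : K)

/-- A closed oriented surface with a finite cell decomposition, given by gluing the sides of
oriented polygons in pairs.  The sides of the polygons are the elements of `Side`, each directed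
along the counterclockwise boundary of its polygon; `face s` is the side following `s` on that
boundary, and `s` is glued to `opp s` with reversal of direction.  Hence the polygons are
the cycles of `face` and the edges of the decomposition are the cycles of `opp`. -/
structure OrientedCellSurface where
  Side : Type
  finite : Finite Side
  face : Equiv.Perm Side
  opp : Equiv.Perm Side
  opp_opp : ∀ s, opp (opp s) = s
  opp_ne : ∀ s, opp s ≠ s

namespace OrientedCellSurface

variable (S : OrientedCellSurface)

/-- The directed edge that follows `s` in counterclockwise order around the initial point of `s`:
the polygon to the left of `s` lies between `s` and the side preceding `s` in it.  Hence the vertices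
of the decomposition are the cycles of `S.rot`, a cycle consisting of the directed edges that
start at that vertex, in counterclockwise order. -/
def rot : Equiv.Perm S.Side := S.opp * S.face⁻¹

/-- The Euler characteristic: vertices minus edges plus faces. -/
noncomputable def eulerChar : ℤ :=
  (Nat.card (PermCycles S.rot) : ℤ) - Nat.card (PermCycles S.opp) + Nat.card (PermCycles S.face)

/-- The surface is connected, i.e. any two sides are related by moving along polygons and across
edges. -/
def Connected : Prop :=
  Nonempty S.Side ∧ ∀ s t : S.Side, ∃ g ∈ Subgroup.closure {S.face, S.opp}, g s = t

/-- The closed oriented surface is a sphere: it is connected and of Euler characteristic two. -/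
def IsSphere : Prop := S.Connected ∧ S.eulerChar = 2

end OrientedCellSurface

/-- An embedding of the graph `G` in an oriented sphere, `G` being identified with the vertices and
edges of a cell decomposition of the sphere.  The half-edge `h` goes to its edge, directed
away from the vertex `vert h`. -/
structure SphereEmbedding {V H : Type*} (G : TrivalentGraph V H) where
  surface : OrientedCellSurface
  isSphere : surface.IsSphere
  side : H ≃ surface.Side
  side_flip : ∀ h, side (G.flip h) = surface.opp (side h)
  side_vert : ∀ h h', surface.rot.SameCycle (side h) (side h') ↔ G.vert h = G.vert h'

/-- Two embeddings of `G` are identified if they differ by an orientation-preserving isomorphism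
of the spheres (which has to be compatible with the embeddings themselves, not just with their
images). -/
def SphereEmbedding.setoid {V H : Type*} (G : TrivalentGraph V H) :
    Setoid (SphereEmbedding G) where
  r A A' := ∃ e : A.surface.Side ≃ A'.surface.Side,
    (∀ s, e (A.surface.face s) = A'.surface.face (e s)) ∧
    (∀ s, e (A.surface.opp s) = A'.surface.opp (e s)) ∧
    ∀ h, e (A.side h) = A'.side h
  iseqv :=
    { refl := fun A => ⟨Equiv.refl _, fun _ => rfl, fun _ => rfl, fun _ => rfl⟩
      symm := by
        rintro A A' ⟨e, h1, h2, h3⟩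
        refine ⟨e.symm, fun s => ?_, fun s => ?_, fun h => ?_⟩
        · rw [Equiv.symm_apply_eq, h1, e.apply_symm_apply]
        · rw [Equiv.symm_apply_eq, h2, e.apply_symm_apply]
        · rw [Equiv.symm_apply_eq, h3]
      trans := by
        rintro A A' A'' ⟨e, h1, h2, h3⟩ ⟨e', h1', h2', h3'⟩
        exact ⟨e.trans e', fun s => by simp [h1, h1'], fun s => by simp [h2, h2'],
          fun h => by simp [h3, h3']⟩ }

/-- The set of embeddings of `G` in an oriented sphere. -/
def SphereEmbeddings {V H : Type*} (G : TrivalentGraph V H) : Type _ :=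
  Quotient (SphereEmbedding.setoid G)

namespace TrivalentGraph

variable {V H : Type*} (G : TrivalentGraph V H)

/-- A rotation system on `G`: a permutation whose cycles are the sets of half-edges at the
vertices. -/
def IsRotation (s : Equiv.Perm H) : Prop := ∀ h h', s.SameCycle h h' ↔ G.vert h = G.vert h'

variable {G} {s : Equiv.Perm H}

theorem IsRotation.vert_apply (hs : G.IsRotation s) (h : H) : G.vert (s h) = G.vert h :=
  ((hs h (s h)).1 (Equiv.Perm.sameCycle_apply_right.2 (Equiv.Perm.SameCycle.refl _ _))).symm

theorem IsRotation.vert_symm_apply (hs : G.IsRotation s) (h : H) :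
    G.vert (s.symm h) = G.vert h := by
  simpa using (hs.vert_apply (s.symm h)).symm

theorem IsRotation.apply_three (hs : G.IsRotation s) (h : H) : s (s (s h)) = h := by
  classical
  have hc : Nat.card {x // G.vert x = G.vert h} = 3 := G.card_fiber _
  have : Finite {x // G.vert x = G.vert h} := Nat.finite_of_card_ne_zero (by omega)
  have : Fintype {x // G.vert x = G.vert h} := Fintype.ofFinite _
  let p : Equiv.Perm {x // G.vert x = G.vert h} := s.subtypePerm (fun x => by rw [hs.vert_apply])
  have hcyc : p.IsCycleOn (Set.univ : Set {x // G.vert x = G.vert h}) :=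
    ⟨Set.bijOn_univ.2 p.bijective, fun x _ y _ =>
      Equiv.Perm.sameCycle_subtypePerm.2 ((hs x.1 y.1).2 (x.2.trans y.2.symm))⟩
  have hcard : (Finset.univ : Finset {x // G.vert x = G.vert h}).card = 3 := by
    rw [Finset.card_univ, ← Nat.card_eq_fintype_card, hc]
  have hp := Equiv.Perm.IsCycleOn.pow_card_apply (s := Finset.univ) (f := p)
    (by simpa using hcyc) (Finset.mem_univ ⟨h, rfl⟩)
  rw [hcard] at hp
  exact congrArg Subtype.val hp

theorem IsRotation.symm_apply (hs : G.IsRotation s) (h : H) : s.symm h = s (s h) := by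
  rw [Equiv.symm_apply_eq, hs.apply_three]

theorem IsRotation.vert_eq_iff (hs : G.IsRotation s) {h h' : H} :
    G.vert h' = G.vert h ↔ h' = h ∨ h' = s h ∨ h' = s (s h) := by
  constructor
  · intro e
    obtain ⟨n, hn⟩ := (hs h h').2 e.symm
    have h3 : ∀ k : ℤ, (s ^ k) h = h ∨ (s ^ k) h = s h ∨ (s ^ k) h = s (s h) := by
      intro k
      induction k with
      | zero => simp
      | succ k ih =>
        rw [add_comm, zpow_add, zpow_one, Equiv.Perm.mul_apply]
        rcases ih with e | e | e <;> rw [e] <;> simp [hs.apply_three]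
      | pred k ih =>
        rw [sub_eq_add_neg, add_comm, zpow_add, zpow_neg_one, Equiv.Perm.mul_apply]
        change s.symm _ = _ ∨ s.symm _ = _ ∨ s.symm _ = _
        rw [hs.symm_apply]
        rcases ih with e | e | e <;> rw [e] <;> simp [hs.apply_three]
    rw [← hn]
    exact h3 n
  · rintro (rfl | rfl | rfl) <;> simp [hs.vert_apply]

theorem IsRotation.apply_ne (hs : G.IsRotation s) (h : H) : s h ≠ h := by
  intro e
  have hc : Nat.card {x // G.vert x = G.vert h} = 3 := G.card_fiber _
  have : Subsingleton {x // G.vert x = G.vert h} := by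
    refine ⟨fun x y => Subtype.ext ?_⟩
    have hx := hs.vert_eq_iff.1 x.2
    have hy := hs.vert_eq_iff.1 y.2
    simp only [e, or_self] at hx hy
    rw [hx, hy]
  have := Finite.card_le_one_iff_subsingleton.2 this
  omega

theorem IsRotation.apply_apply_ne (hs : G.IsRotation s) (h : H) : s (s h) ≠ h := fun e =>
  hs.apply_ne h (by conv_rhs => rw [← hs.apply_three h, e])

theorem IsRotation.inv (hs : G.IsRotation s) : G.IsRotation s.symm := fun h h' =>
  Equiv.Perm.sameCycle_inv.trans (hs h h')

/-- Two rotation systems agree or are opposite at every vertex. -/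
theorem IsRotation.eq_or_eq_inv {s' : Equiv.Perm H} (hs : G.IsRotation s) (hs' : G.IsRotation s')
    (v : V) : (∀ h, G.vert h = v → s' h = s h) ∨ ∀ h, G.vert h = v → s' h = s.symm h := by
  obtain ⟨h, rfl⟩ := G.vert_surjective v
  have key : ∀ t : Equiv.Perm H, G.IsRotation t → s' h = t h →
      ∀ g, G.vert g = G.vert h → s' g = t g := by
    intro t ht e g hg
    have e2 : s' (s' h) = t (t h) := by
      rcases ht.vert_eq_iff.1 ((hs'.vert_apply (s' h)).trans (hs'.vert_apply h)) with e' | e' | e'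
      · exact absurd e' (hs'.apply_apply_ne h)
      · exact absurd (e'.trans e.symm) (hs'.apply_ne _)
      · exact e'
    rcases ht.vert_eq_iff.1 hg with rfl | rfl | rfl
    · exact e
    · rw [← e2, e]
    · rw [ht.apply_three, ← e2, hs'.apply_three]
  rcases hs.vert_eq_iff.1 (hs'.vert_apply h) with e | e | e
  · exact absurd e (hs'.apply_ne h)
  · exact Or.inl (key s hs e)
  · exact Or.inr (key s.symm hs.inv (e.trans (hs.symm_apply h).symm))

/-- The half-edges, listed vertex by vertex. -/
noncomputable def IsRotation.equivHalf (hs : G.IsRotation s) : V × Fin 3 ≃ H :=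
  Equiv.ofBijective (fun p => (s ^ (p.2 : ℕ)) (G.halfAt p.1)) <| by
    have hv : ∀ v (i : Fin 3), G.vert ((s ^ (i : ℕ)) (G.halfAt v)) = v := by
      intro v i
      have : G.vert (G.halfAt v) = v := Function.surjInv_eq _ v
      fin_cases i <;> simp [pow_two, hs.vert_apply, this]
    constructor
    · rintro ⟨v, i⟩ ⟨w, j⟩ e
      have hvw : v = w := by rw [← hv v i, ← hv w j]; exact congrArg G.vert e
      subst hvw
      have h1 := hs.apply_ne (G.halfAt v)
      have h2 := hs.apply_apply_ne (G.halfAt v)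
      have h3 := hs.apply_ne (s (G.halfAt v))
      fin_cases i <;> fin_cases j
      · rfl
      · exact absurd e.symm h1
      · exact absurd e.symm h2
      · exact absurd e h1
      · rfl
      · exact absurd e.symm h3
      · exact absurd e h2
      · exact absurd e h3
      · rfl
    · intro h
      have : G.vert (G.halfAt (G.vert h)) = G.vert h := Function.surjInv_eq _ _
      rcases hs.vert_eq_iff.1 this.symm with e | e | e
      · exact ⟨(G.vert h, 0), by simpa using e.symm⟩
      · exact ⟨(G.vert h, 1), by simpa using e.symm⟩
      · exact ⟨(G.vert h, 2), by simpa [pow_two] using e.symm⟩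

theorem vert_halfAt (v : V) : G.vert (G.halfAt v) = v := Function.surjInv_eq _ v

@[to_additive]
theorem IsRotation.prod_half [Fintype V] [Fintype H] {M : Type*} [CommMonoid M]
    (hs : G.IsRotation s) (f : H → M) :
    ∏ h, f h = ∏ v, f (G.halfAt v) * f (s (G.halfAt v)) * f (s (s (G.halfAt v))) := by
  rw [← hs.equivHalf.prod_comp, Fintype.prod_prod_type]
  refine Finset.prod_congr rfl fun v _ => ?_
  rw [Fin.prod_univ_three]
  rfl

theorem IsRotation.card_half [Fintype V] [Fintype H] (hs : G.IsRotation s) :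
    Fintype.card H = 3 * Fintype.card V := by
  rw [← Fintype.card_congr hs.equivHalf, Fintype.card_prod, Fintype.card_fin, mul_comm]

theorem sameCycle_flip_iff {h h' : H} : G.flip.SameCycle h h' ↔ h' = h ∨ h' = G.flip h := by
  constructor
  · rintro ⟨n, rfl⟩
    have h2 : G.flip ^ (2 : ℤ) = 1 := by
      ext g
      exact G.flip_flip g
    rcases Int.even_or_odd' n with ⟨k, rfl | rfl⟩
    · left; rw [zpow_mul, h2]; simp
    · right; rw [zpow_add, zpow_mul, h2]; simp
  · rintro (rfl | rfl)
    · exact Equiv.Perm.SameCycle.refl _ _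
    · exact Equiv.Perm.sameCycle_apply_right.2 (Equiv.Perm.SameCycle.refl _ _)

/-- The edge of a half-edge. -/
def edgeOf (G : TrivalentGraph V H) (h : H) : G.Edge := Quotient.mk _ h

theorem edgeOf_eq_iff {h h' : H} : G.edgeOf h = G.edgeOf h' ↔ h' = h ∨ h' = G.flip h := by
  rw [← sameCycle_flip_iff]
  exact Quotient.eq

theorem edgeOf_flip (h : H) : G.edgeOf (G.flip h) = G.edgeOf h :=
  (edgeOf_eq_iff.2 (Or.inr rfl)).symm

theorem edgeOf_out (e : G.Edge) : G.edgeOf e.out = e := Quotient.out_eq e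

theorem out_edgeOf (h : H) : (G.edgeOf h).out = h ∨ (G.edgeOf h).out = G.flip h :=
  edgeOf_eq_iff.1 (edgeOf_out (G.edgeOf h)).symm

/-- The half-edges, listed edge by edge. -/
noncomputable def equivHalfEdge (G : TrivalentGraph V H) : G.Edge × Fin 2 ≃ H :=
  Equiv.ofBijective (fun p => (G.flip ^ (p.2 : ℕ)) p.1.out) <| by
    have hv : ∀ e (i : Fin 2), G.edgeOf ((G.flip ^ (i : ℕ)) (e : G.Edge).out) = e := by
      intro e i
      fin_cases i <;> simp [edgeOf_flip, edgeOf_out]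
    constructor
    · rintro ⟨v, i⟩ ⟨w, j⟩ e
      have hvw : v = w := by rw [← hv v i, ← hv w j]; exact congrArg G.edgeOf e
      subst hvw
      have h1 := G.flip_ne v.out
      fin_cases i <;> fin_cases j
      · rfl
      · exact absurd e.symm h1
      · exact absurd e h1
      · rfl
    · intro h
      rcases out_edgeOf (G := G) h with e | e
      · exact ⟨(G.edgeOf h, 0), by simpa using e⟩
      · exact ⟨(G.edgeOf h, 1), by simp [e, G.flip_flip]⟩

open Classical in
@[to_additive]
theorem prod_half_edge [Fintype H] {M : Type*} [CommMonoid M] (G : TrivalentGraph V H)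
    (f : H → M) : ∏ h, f h = ∏ e : G.Edge, f e.out * f (G.flip e.out) := by
  rw [← G.equivHalfEdge.prod_comp, Fintype.prod_prod_type]
  refine Finset.prod_congr rfl fun v _ => ?_
  rw [Fin.prod_univ_two]
  rfl

theorem card_half_edge [Fintype H] (G : TrivalentGraph V H) :
    Fintype.card H = 2 * Nat.card G.Edge := by
  rw [← Nat.card_eq_fintype_card, ← Nat.card_congr G.equivHalfEdge, Nat.card_prod, mul_comm]
  simp

end TrivalentGraph

namespace OrientedTrivalentGraph

variable {V H : Type*} (G : OrientedTrivalentGraph V H)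

theorem isRotation_next : G.IsRotation G.next := G.sameCycle_next

/-- The rotation system that differs from the one of `G` by the signs `ε` at the vertices. -/
def rot (ε : V → ℤˣ) : Equiv.Perm H where
  toFun h := if ε (G.vert h) = 1 then G.next h else G.next.symm h
  invFun h := if ε (G.vert h) = 1 then G.next.symm h else G.next h
  left_inv h := by
    by_cases e : ε (G.vert h) = 1
    · simp [e, G.isRotation_next.vert_apply]
    · dsimp only
      rw [if_neg e, G.isRotation_next.vert_symm_apply, if_neg e, Equiv.apply_symm_apply]
  right_inv h := by
    by_cases e : ε (G.vert h) = 1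
    · dsimp only
      rw [if_pos e, G.isRotation_next.vert_symm_apply, if_pos e, Equiv.apply_symm_apply]
    · simp [e, G.isRotation_next.vert_apply]

variable {G} {ε : V → ℤˣ}

theorem rot_of_pos {h : H} (e : ε (G.vert h) = 1) : G.rot ε h = G.next h := if_pos e

theorem rot_of_neg {h : H} (e : ε (G.vert h) = -1) : G.rot ε h = G.next.symm h :=
  if_neg (by rw [e]; decide)

theorem isRotation_rot (ε : V → ℤˣ) : G.IsRotation (G.rot ε) := by
  have hv : ∀ h, G.vert (G.rot ε h) = G.vert h := by
    intro h
    rcases Int.units_eq_one_or (ε (G.vert h)) with e | e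
    · rw [rot_of_pos e, G.isRotation_next.vert_apply]
    · rw [rot_of_neg e, G.isRotation_next.vert_symm_apply]
  intro h h'
  constructor
  · rintro ⟨n, rfl⟩
    induction n with
    | zero => rfl
    | succ k ih => rw [add_comm, zpow_add, zpow_one, Equiv.Perm.mul_apply, hv, ih]
    | pred k ih =>
      rw [ih, sub_eq_add_neg, add_comm, zpow_add, zpow_neg_one, Equiv.Perm.mul_apply]
      simpa using hv ((G.rot ε)⁻¹ (((G.rot ε) ^ (-(k : ℤ))) h))
  · intro e
    have h1 : ∀ g, (G.rot ε).SameCycle g (G.rot ε g) := fun g =>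
      Equiv.Perm.sameCycle_apply_right.2 (Equiv.Perm.SameCycle.refl _ _)
    rcases Int.units_eq_one_or (ε (G.vert h)) with e1 | e1
    · rcases G.isRotation_next.vert_eq_iff.1 e.symm with rfl | rfl | rfl
      · exact Equiv.Perm.SameCycle.refl _ _
      · simpa [rot_of_pos e1] using h1 h
      · have := h1 (G.rot ε h)
        rw [rot_of_pos (h := G.rot ε h) (by rw [hv, e1]), rot_of_pos e1] at this
        exact (by simpa [rot_of_pos e1] using h1 h : (G.rot ε).SameCycle h (G.next h)).trans this
    · rcases G.isRotation_next.inv.vert_eq_iff.1 e.symm with rfl | rfl | rfl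
      · exact Equiv.Perm.SameCycle.refl _ _
      · simpa [rot_of_neg e1] using h1 h
      · have := h1 (G.rot ε h)
        rw [rot_of_neg (h := G.rot ε h) (by rw [hv, e1]), rot_of_neg e1] at this
        exact (by simpa [rot_of_neg e1] using h1 h :
          (G.rot ε).SameCycle h (G.next.symm h)).trans this

theorem rot_injective : Function.Injective G.rot := by
  intro ε ε' e
  funext v
  have h := DFunLike.congr_fun e (G.halfAt v)
  have hne : G.next (G.halfAt v) ≠ G.next.symm (G.halfAt v) := by
    rw [G.isRotation_next.symm_apply]
    exact fun e => G.isRotation_next.apply_ne _ e.symm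
  rcases Int.units_eq_one_or (ε v) with e1 | e1 <;> rcases Int.units_eq_one_or (ε' v) with e2 | e2
  · rw [e1, e2]
  · rw [rot_of_pos (by rw [G.vert_halfAt, e1]), rot_of_neg (by rw [G.vert_halfAt, e2])] at h
    exact absurd h hne
  · rw [rot_of_neg (by rw [G.vert_halfAt, e1]), rot_of_pos (by rw [G.vert_halfAt, e2])] at h
    exact absurd h.symm hne
  · rw [e1, e2]

theorem exists_rot_eq {s : Equiv.Perm H} (hs : G.IsRotation s) : ∃ ε, G.rot ε = s := by
  classical
  refine ⟨fun v => if ∀ h, G.vert h = v → s h = G.next h then 1 else -1, ?_⟩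
  ext h
  by_cases e : ∀ h', G.vert h' = G.vert h → s h' = G.next h'
  · rw [rot_of_pos (by exact if_pos e), e h rfl]
  · rw [rot_of_neg (by exact if_neg e),
      ((G.isRotation_next.eq_or_eq_inv hs _).resolve_left e) h rfl]

end OrientedTrivalentGraph

theorem LinearMap.finrank_range_add_one_of_ker {F X W : Type*} [Field F] [Fintype X] [Nonempty X]
    [AddCommGroup W] [Module F W] (g : (X → F) →ₗ[F] W)
    (hg : ∀ a, g a = 0 ↔ ∀ x y, a x = a y) :
    Module.finrank F (LinearMap.range g) + 1 = Fintype.card X := by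
  have hk : LinearMap.ker g = Submodule.span F {(fun _ => 1 : X → F)} := by
    ext a
    rw [LinearMap.mem_ker, hg, Submodule.mem_span_singleton]
    constructor
    · intro h
      obtain ⟨x⟩ := ‹Nonempty X›
      exact ⟨a x, funext fun y => by simp [h x y]⟩
    · rintro ⟨c, rfl⟩ x y
      rfl
  have h1 : Module.finrank F (LinearMap.ker g) = 1 := by
    rw [hk]
    refine finrank_span_singleton fun e => ?_
    obtain ⟨x⟩ := ‹Nonempty X›
    exact one_ne_zero (congrFun e x)
  have := LinearMap.finrank_range_add_finrank_ker g
  rw [h1, Module.finrank_fintype_fun_eq_card] at this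
  exact this

theorem LinearMap.finrank_range_eq_of_adjoint {F m n : Type*} [Field F] [Fintype m] [Fintype n]
    (f : (n → F) →ₗ[F] (m → F)) (g : (m → F) →ₗ[F] (n → F))
    (h : ∀ x c, c ⬝ᵥ f x = g c ⬝ᵥ x) :
    Module.finrank F (LinearMap.range f) = Module.finrank F (LinearMap.range g) := by
  classical
  have hm : LinearMap.toMatrix' g = (LinearMap.toMatrix' f).transpose := by
    ext i j
    have := h (Pi.single i 1) (Pi.single j 1)
    simpa [LinearMap.toMatrix'_apply] using this.symm
  have h1 := Matrix.rank_transpose (LinearMap.toMatrix' f)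
  rw [← hm, Matrix.rank, Matrix.rank, ← Matrix.toLin'_apply', ← Matrix.toLin'_apply',
    Matrix.toLin'_toMatrix', Matrix.toLin'_toMatrix'] at h1
  exact h1.symm

theorem LinearMap.mem_range_of_adjoint {F m n : Type*} [Field F] [Fintype m] [Fintype n]
    (f : (n → F) →ₗ[F] (m → F)) (g : (m → F) →ₗ[F] (n → F))
    (h : ∀ x c, c ⬝ᵥ f x = g c ⬝ᵥ x) (y : n → F) (hy : ∀ x, f x = 0 → y ⬝ᵥ x = 0) :
    ∃ c, g c = y := by
  classical
  have hmem : dotProductEquiv F n y ∈ LinearMap.range f.dualMap := by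
    rw [LinearMap.range_dualMap_eq_dualAnnihilator_ker, Submodule.mem_dualAnnihilator]
    exact fun x hx => hy x hx
  obtain ⟨ψ, hψ⟩ := hmem
  refine ⟨(dotProductEquiv F m).symm ψ, dotProduct_eq _ _ fun x => ?_⟩
  rw [← h, ← dotProductEquiv_apply_apply, LinearEquiv.apply_symm_apply,
    ← dotProductEquiv_apply_apply F n y x, ← hψ, LinearMap.dualMap_apply]

namespace TrivalentGraph

variable {V H : Type*} {G : TrivalentGraph V H} {s : Equiv.Perm H}

theorem eq_of_connected {S : Set H} (hG : (G.graphDeleting S).Connected) {α : Type*} (c : V → α)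
    (hc : ∀ h, h ∉ S → G.flip h ∉ S → c (G.vert h) = c (G.vert (G.flip h))) (v w : V) :
    c v = c w := by
  obtain ⟨p⟩ := hG.preconnected v w
  induction p with
  | nil => rfl
  | cons adj _ ih =>
    rw [← ih]
    rcases ((SimpleGraph.fromRel_adj _ _ _).1 adj).2 with
      ⟨h, h1, h2, rfl, rfl⟩ | ⟨h, h1, h2, rfl, rfl⟩
    · exact hc h h1 h2
    · exact (hc h h1 h2).symm

theorem exists_cut [Nonempty V] {S : Set H} (hG : ¬ (G.graphDeleting S).Connected) :
    ∃ c : V → ZMod 2, (∀ h, h ∉ S → G.flip h ∉ S → c (G.vert h) = c (G.vert (G.flip h))) ∧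
      ∃ v w, c v ≠ c w := by
  classical
  have : ¬ (G.graphDeleting S).Preconnected := fun h => hG ⟨h⟩
  simp only [SimpleGraph.Preconnected, not_forall] at this
  obtain ⟨v, w, hvw⟩ := this
  refine ⟨fun x => if (G.graphDeleting S).Reachable v x then 1 else 0, fun h h1 h2 => ?_,
    v, w, ?_⟩
  · by_cases e : G.vert h = G.vert (G.flip h)
    · rw [e]
    · have adj : (G.graphDeleting S).Adj (G.vert h) (G.vert (G.flip h)) :=
        (SimpleGraph.fromRel_adj _ _ _).2 ⟨e, Or.inl ⟨h, h1, h2, rfl, rfl⟩⟩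
      have : (G.graphDeleting S).Reachable v (G.vert h) ↔
          (G.graphDeleting S).Reachable v (G.vert (G.flip h)) :=
        ⟨fun r => r.trans adj.reachable, fun r => r.trans adj.symm.reachable⟩
      simp only [this]
  · simp [hvw]

/-- The cycles modulo 2, as sets of half-edges. -/
structure IsCycle (G : TrivalentGraph V H) (x : H → ZMod 2) : Prop where
  flip : ∀ h, x (G.flip h) = x h
  sum : ∀ h h' h'', h ≠ h' → h ≠ h'' → h' ≠ h'' → G.vert h = G.vert h' → G.vert h = G.vert h'' →
    x h + x h' + x h'' = 0

theorem IsCycle.sum_rotation {x : H → ZMod 2} (hx : G.IsCycle x) (hs : G.IsRotation s) (h : H) :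
    x h + x (s h) + x (s (s h)) = 0 :=
  hx.sum _ _ _ (hs.apply_ne h).symm (hs.apply_apply_ne h).symm (hs.apply_ne _).symm
    (hs.vert_apply h).symm (by simp [hs.vert_apply])

theorem isCycle_of_rotation {x : H → ZMod 2} (hs : G.IsRotation s)
    (h1 : ∀ h, x (G.flip h) = x h) (h2 : ∀ h, x h + x (s h) + x (s (s h)) = 0) : G.IsCycle x where
  flip := h1
  sum h h' h'' n1 n2 n3 e1 e2 := by
    rcases hs.vert_eq_iff.1 e1.symm with rfl | rfl | rfl <;>
      rcases hs.vert_eq_iff.1 e2.symm with rfl | rfl | rfl <;> try contradiction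
    · exact h2 h
    · rw [← h2 h]; ring

/-- The permutation whose cycles are the faces of the rotation system `s`. -/
def facePerm (G : TrivalentGraph V H) (s : Equiv.Perm H) : Equiv.Perm H := s⁻¹ * G.flip

/-- The number of faces of the rotation system `s`. -/
noncomputable def numFaces (G : TrivalentGraph V H) (s : Equiv.Perm H) : ℕ :=
  Nat.card (PermCycles (G.facePerm s))

/-- Every cycle modulo 2 is the boundary of a set of faces of the rotation system `s`. -/
def Exact (G : TrivalentGraph V H) (s : Equiv.Perm H) : Prop :=
  ∀ x, G.IsCycle x → ∃ a : H → ZMod 2, (∀ h, a h + a (G.flip h) = x h) ∧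
    ∀ h, a (G.flip h) = a (s.symm h)

theorem facePerm_apply (h : H) : G.facePerm s h = s.symm (G.flip h) := rfl

/-- The face to the left of a half-edge. -/
def faceOf (G : TrivalentGraph V H) (s : Equiv.Perm H) (h : H) : PermCycles (G.facePerm s) :=
  Quotient.mk _ h

theorem faceOf_flip (h : H) : G.faceOf s (G.flip h) = G.faceOf s (s.symm h) := by
  refine Quotient.sound ?_
  have : G.facePerm s (G.flip h) = s.symm h := by rw [facePerm_apply, G.flip_flip]
  rw [← this]
  exact Equiv.Perm.sameCycle_apply_right.2 (Equiv.Perm.SameCycle.refl _ _)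

theorem exists_faceOf_of_invariant {α : Type*} {a : H → α}
    (ha : ∀ h, a (G.flip h) = a (s.symm h)) :
    ∃ b : PermCycles (G.facePerm s) → α, ∀ h, a h = b (G.faceOf s h) := by
  have h1 : ∀ h, a (G.facePerm s h) = a h := fun h => by
    rw [facePerm_apply, ← ha, G.flip_flip]
  refine ⟨Quotient.lift a ?_, fun h => rfl⟩
  rintro h _ ⟨n, rfl⟩
  induction n with
  | zero => rfl
  | succ k ih => rw [add_comm, zpow_add, zpow_one, Equiv.Perm.mul_apply, h1, ih]
  | pred k ih =>
    rw [ih, sub_eq_add_neg, add_comm, zpow_add, zpow_neg_one, Equiv.Perm.mul_apply]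
    rw [← h1 ((G.facePerm s)⁻¹ _)]
    simp

theorem isCycle_boundary (hs : G.IsRotation s) {a : H → ZMod 2}
    (ha : ∀ h, a (G.flip h) = a (s.symm h)) : G.IsCycle fun h => a h + a (G.flip h) := by
  refine isCycle_of_rotation hs (fun h => by rw [G.flip_flip, add_comm]) fun h => ?_
  simp only [ha, Equiv.symm_apply_apply, hs.symm_apply h]
  linear_combination (a h + a (s h) + a (s (s h))) * (CharTwo.two_eq_zero : (2 : ZMod 2) = 0)

/-- The coboundary map modulo 2. -/
noncomputable def coboundary (G : TrivalentGraph V H) :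
    (V → ZMod 2) →ₗ[ZMod 2] (G.Edge → ZMod 2) where
  toFun c e := c (G.vert e.out) + c (G.vert (G.flip e.out))
  map_add' c d := by ext e; simp only [Pi.add_apply]; ring
  map_smul' r c := by ext e; simp [mul_add]

/-- The boundary map modulo 2. -/
noncomputable def boundary (G : TrivalentGraph V H) (s : Equiv.Perm H) :
    (G.Edge → ZMod 2) →ₗ[ZMod 2] (V → ZMod 2) where
  toFun y v := y (G.edgeOf (G.halfAt v)) + y (G.edgeOf (s (G.halfAt v))) +
    y (G.edgeOf (s (s (G.halfAt v))))
  map_add' c d := by ext e; simp only [Pi.add_apply]; ring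
  map_smul' r c := by ext e; simp [mul_add]

/-- The boundary map from faces to edges modulo 2. -/
noncomputable def faceBoundary (G : TrivalentGraph V H) (s : Equiv.Perm H) :
    (PermCycles (G.facePerm s) → ZMod 2) →ₗ[ZMod 2] (G.Edge → ZMod 2) where
  toFun a e := a (G.faceOf s e.out) + a (G.faceOf s (G.flip e.out))
  map_add' c d := by ext e; simp only [Pi.add_apply]; ring
  map_smul' r c := by ext e; simp [mul_add]

theorem coboundary_edgeOf (c : V → ZMod 2) (h : H) :
    G.coboundary c (G.edgeOf h) = c (G.vert h) + c (G.vert (G.flip h)) := by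
  change c _ + c _ = _
  rcases out_edgeOf (G := G) h with e | e <;> rw [e]
  rw [G.flip_flip, add_comm]

theorem faceBoundary_edgeOf (a : PermCycles (G.facePerm s) → ZMod 2) (h : H) :
    G.faceBoundary s a (G.edgeOf h) = a (G.faceOf s h) + a (G.faceOf s (G.flip h)) := by
  change a _ + a _ = _
  rcases out_edgeOf (G := G) h with e | e <;> rw [e]
  rw [G.flip_flip, add_comm]

theorem boundary_eq_zero_iff (hs : G.IsRotation s) (y : G.Edge → ZMod 2) :
    G.boundary s y = 0 ↔ G.IsCycle fun h => y (G.edgeOf h) := by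
  constructor
  · refine fun h0 => isCycle_of_rotation hs (fun h => by rw [edgeOf_flip]) fun h => ?_
    have := congrFun h0 (G.vert h)
    change _ + _ + _ = (0 : ZMod 2) at this
    rcases hs.vert_eq_iff.1 (G.vert_halfAt (G.vert h)) with e | e | e <;> rw [e] at this <;>
      (try simp only [hs.apply_three] at this) <;> rw [← this] <;> ring
  · intro h
    funext v
    exact h.sum_rotation hs (G.halfAt v)

theorem range_faceBoundary_le (hs : G.IsRotation s) :
    LinearMap.range (G.faceBoundary s) ≤ LinearMap.ker (G.boundary s) := by
  rintro _ ⟨a, rfl⟩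
  rw [LinearMap.mem_ker, boundary_eq_zero_iff hs]
  simp only [faceBoundary_edgeOf]
  exact isCycle_boundary hs (a := fun h => a (G.faceOf s h)) fun h => by rw [faceOf_flip]

theorem exact_iff_range_eq (hs : G.IsRotation s) :
    G.Exact s ↔ LinearMap.range (G.faceBoundary s) = LinearMap.ker (G.boundary s) := by
  constructor
  · refine fun hE => le_antisymm (range_faceBoundary_le hs) fun y hy => ?_
    obtain ⟨a, h1, h2⟩ := hE _ ((boundary_eq_zero_iff hs y).1 hy)
    obtain ⟨b, hb⟩ := exists_faceOf_of_invariant h2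
    refine ⟨b, funext fun e => ?_⟩
    rw [← edgeOf_out e, faceBoundary_edgeOf, ← hb, ← hb, h1]
  · intro hr x hx
    have hx' : ∀ h, x (G.edgeOf h).out = x h := fun h => by
      rcases out_edgeOf (G := G) h with e | e <;> rw [e]
      exact hx.flip h
    have : (fun e : G.Edge => x e.out) ∈ LinearMap.range (G.faceBoundary s) := by
      rw [hr, LinearMap.mem_ker, boundary_eq_zero_iff hs]
      simpa only [hx'] using hx
    obtain ⟨a, ha⟩ := this
    refine ⟨fun h => a (G.faceOf s h), fun h => ?_, fun h => congrArg a (faceOf_flip h)⟩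
    rw [← faceBoundary_edgeOf, ha]
    exact hx' h

section Finite

variable [Fintype H]

open Classical in
theorem boundary_adjoint [Fintype V] (hs : G.IsRotation s) (y : G.Edge → ZMod 2) (c : V → ZMod 2) :
    c ⬝ᵥ G.boundary s y = G.coboundary c ⬝ᵥ y := by
  have h1 := hs.sum_half fun h => c (G.vert h) * y (G.edgeOf h)
  have h2 := G.sum_half_edge fun h => c (G.vert h) * y (G.edgeOf h)
  rw [h1] at h2
  simp only [dotProduct]
  convert h2 using 2 with v _ e _
  · rw [hs.vert_apply, hs.vert_apply, hs.vert_apply, G.vert_halfAt, ← mul_add, ← mul_add]; rfl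
  · rw [edgeOf_flip, edgeOf_out, ← add_mul]; rfl

theorem exists_cycle_of_connected [Fintype V] (hs : G.IsRotation s) (h : H)
    (hG : (G.graphDeleting {h, G.flip h}).Connected) : ∃ x, G.IsCycle x ∧ x h = 1 := by
  classical
  by_contra hne
  obtain ⟨c, hc⟩ := LinearMap.mem_range_of_adjoint (G.boundary s) G.coboundary
    (boundary_adjoint hs) (Pi.single (G.edgeOf h) 1) (fun y hy => by
      rw [single_dotProduct, one_mul]
      by_contra h0
      exact hne ⟨_, (boundary_eq_zero_iff hs y).1 hy, (Fin.eq_one_of_ne_zero _ h0)⟩)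
  have hconst := eq_of_connected hG c fun g h1 h2 => by
    have := congrFun hc (G.edgeOf g)
    rw [coboundary_edgeOf, Pi.single_eq_of_ne] at this
    · exact CharTwo.add_eq_zero.1 this
    · intro e
      rcases edgeOf_eq_iff.1 e with e | e
      · exact h1 (Or.inl e.symm)
      · exact h2 (Or.inl e.symm)
  have := congrFun hc (G.edgeOf h)
  rw [coboundary_edgeOf, Pi.single_eq_same, hconst (G.vert (G.flip h)) (G.vert h),
    CharTwo.add_self_eq_zero] at this
  exact zero_ne_one this

theorem finrank_cycles [Fintype V] (hs : G.IsRotation s) (hG : G.Connected) :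
    Module.finrank (ZMod 2) (LinearMap.ker (G.boundary s)) + Fintype.card V =
      Nat.card G.Edge + 1 := by
  classical
  have : Nonempty V := hG.nonempty
  have h1 := LinearMap.finrank_range_add_one_of_ker G.coboundary (by
    intro c
    constructor
    · intro h0
      refine eq_of_connected hG c fun h _ _ => ?_
      have := congrFun h0 (G.edgeOf h)
      rw [coboundary_edgeOf] at this
      exact CharTwo.add_eq_zero.1 this
    · intro h
      funext e
      exact CharTwo.add_eq_zero.2 (h _ _))
  have h2 := LinearMap.finrank_range_add_finrank_ker (G.boundary s)
  rw [LinearMap.finrank_range_eq_of_adjoint _ _ (boundary_adjoint hs),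
    Module.finrank_fintype_fun_eq_card, ← Nat.card_eq_fintype_card] at h2
  omega

theorem finrank_range_faceBoundary (hs : G.IsRotation s) (hG : G.Connected) :
    Module.finrank (ZMod 2) (LinearMap.range (G.faceBoundary s)) + 1 = G.numFaces s := by
  classical
  obtain ⟨v⟩ : Nonempty V := hG.nonempty
  have : Nonempty (PermCycles (G.facePerm s)) := ⟨G.faceOf s (G.halfAt v)⟩
  rw [numFaces, Nat.card_eq_fintype_card]
  refine LinearMap.finrank_range_add_one_of_ker _ fun a => ⟨fun h0 => ?_, fun h => ?_⟩
  · have h1 : ∀ h, a (G.faceOf s h) = a (G.faceOf s (G.flip h)) := fun h => by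
      have := congrFun h0 (G.edgeOf h)
      rw [faceBoundary_edgeOf] at this
      exact CharTwo.add_eq_zero.1 this
    have h2 : ∀ h, a (G.faceOf s (s h)) = a (G.faceOf s h) := fun h => by
      rw [h1, faceOf_flip, Equiv.symm_apply_apply]
    have h3 : ∀ h, a (G.faceOf s (G.halfAt (G.vert h))) = a (G.faceOf s h) := fun h => by
      rcases hs.vert_eq_iff.1 (G.vert_halfAt (G.vert h)) with e | e | e <;> rw [e] <;> simp [h2]
    have h4 := eq_of_connected hG (fun v => a (G.faceOf s (G.halfAt v))) fun h _ _ => by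
      rw [h3, h3, ← h1]
    intro x y
    induction x using Quotient.inductionOn with | _ x
    induction y using Quotient.inductionOn with | _ y
    exact (h3 x).symm.trans ((h4 _ _).trans (h3 y))
  · funext e
    exact CharTwo.add_eq_zero.2 (h _ _)

theorem numFaces_le [Fintype V] (hs : G.IsRotation s) (hG : G.Connected) :
    G.numFaces s ≤ Fintype.card V / 2 + 2 := by
  have h1 := finrank_cycles hs hG
  have h2 := finrank_range_faceBoundary hs hG
  have h3 := Submodule.finrank_mono (range_faceBoundary_le hs)
  have h4 := hs.card_half
  have h5 := G.card_half_edge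
  omega

theorem numFaces_eq_iff [Fintype V] (hs : G.IsRotation s) (hG : G.Connected) :
    G.numFaces s = Fintype.card V / 2 + 2 ↔ G.Exact s := by
  have h1 := finrank_cycles hs hG
  have h2 := finrank_range_faceBoundary hs hG
  have h4 := hs.card_half
  have h5 := G.card_half_edge
  rw [exact_iff_range_eq hs]
  constructor
  · exact fun h => Submodule.eq_of_le_of_finrank_eq (range_faceBoundary_le hs) (by omega)
  · intro h
    rw [h] at h2
    omega

end Finite

end TrivalentGraph

theorem TrivalentGraph.Exact.faceOf_ne {V H : Type*} [Fintype V] [Fintype H]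
    {G : TrivalentGraph V H} {s : Equiv.Perm H} (hs : G.IsRotation s) (hE : G.Exact s)
    (hG : G.TwoConnected) (h : H) : G.faceOf s h ≠ G.faceOf s (s.symm h) := by
  intro e
  obtain ⟨x, hx, h1⟩ := exists_cycle_of_connected hs h (hG.2 h)
  obtain ⟨a, ha, ha'⟩ := hE x hx
  obtain ⟨b, hb⟩ := exists_faceOf_of_invariant ha'
  have := ha h
  rw [ha', hb, hb, e, CharTwo.add_self_eq_zero, h1] at this
  exact zero_ne_one this

theorem sum_sum_lt_ite {n : ℕ} (p q : Fin n) :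
    ∑ i, ∑ j, (if i < j then (if p = i then 1 else 0) * (if q = j then 1 else 0) else 0 : ZMod 2) =
      if p < q then 1 else 0 := by
  rw [Finset.sum_eq_single p, Finset.sum_eq_single q]
  · simp
  · intro j _ hj
    simp [hj.symm]
  · simp
  · intro i _ hi
    simp [hi.symm]
  · simp

theorem sum_sum_lt_wedge {n : ℕ} {p q r : Fin n} (hpq : p ≠ q) (hqr : q ≠ r) (hpr : p ≠ r) :
    ∑ i, ∑ j, (if i < j then
      ((if p = i then 1 else 0) + (if r = i then 1 else 0)) *
        ((if q = j then 1 else 0) + (if p = j then 1 else 0)) +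
      ((if q = i then 1 else 0) + (if p = i then 1 else 0)) *
        ((if p = j then 1 else 0) + (if r = j then 1 else 0)) else 0 : ZMod 2) = 1 := by
  let T : Fin n → Fin n → ZMod 2 := fun p q =>
    ∑ i, ∑ j, if i < j then (if p = i then 1 else 0) * (if q = j then 1 else 0) else 0
  have key : ∀ p q, T p q = if p < q then 1 else 0 := sum_sum_lt_ite
  have : ∑ i, ∑ j, (if i < j then
      ((if p = i then 1 else 0) + (if r = i then 1 else 0)) *
        ((if q = j then 1 else 0) + (if p = j then 1 else 0)) +
      ((if q = i then 1 else 0) + (if p = i then 1 else 0)) *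
        ((if p = j then 1 else 0) + (if r = j then 1 else 0)) else 0 : ZMod 2) =
      T p q + T p p + T r q + T r p + (T q p + T q r + T p p + T p r) := by
    simp only [T, ← Finset.sum_add_distrib]
    refine Finset.sum_congr rfl fun i _ => Finset.sum_congr rfl fun j _ => ?_
    by_cases h : i < j
    · simp only [if_pos h]
      ring
    · simp only [if_neg h, add_zero]
  rw [this]
  simp only [key, lt_irrefl, if_false]
  rcases lt_or_gt_of_ne hpq with h1 | h1 <;> rcases lt_or_gt_of_ne hqr with h2 | h2 <;>
    rcases lt_or_gt_of_ne hpr with h3 | h3 <;>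
    simp only [h1, h2, h3, h1.not_gt, h2.not_gt, h3.not_gt, if_true, if_false] <;> decide

namespace OrientedTrivalentGraph

variable {V H : Type*} {G : OrientedTrivalentGraph V H} {ε ε' : V → ℤˣ}

theorem rot_congr {h : H} (e : ε' (G.vert h) = ε (G.vert h)) : G.rot ε' h = G.rot ε h := by
  change (if _ then _ else _) = (if _ then _ else _)
  rw [e]

theorem rot_eq_symm {h : H} (e : ε' (G.vert h) ≠ ε (G.vert h)) :
    G.rot ε' h = (G.rot ε).symm h := by
  rw [Equiv.eq_symm_apply]
  have hv := (isRotation_rot (G := G) ε').vert_apply h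
  rcases Int.units_eq_one_or (ε (G.vert h)) with e1 | e1 <;>
    rcases Int.units_eq_one_or (ε' (G.vert h)) with e2 | e2
  · exact absurd (e2.trans e1.symm) e
  · rw [rot_of_pos (by rw [hv, e1]), rot_of_neg e2, Equiv.apply_symm_apply]
  · rw [rot_of_neg (by rw [hv, e1]), rot_of_pos e2, Equiv.symm_apply_apply]
  · exact absurd (e2.trans e1.symm) e

theorem rot_symm_congr {h : H} (e : ε' (G.vert h) = ε (G.vert h)) :
    (G.rot ε').symm h = (G.rot ε).symm h := by
  have hs := isRotation_rot (G := G) ε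
  rw [Equiv.symm_apply_eq, rot_congr (by rw [hs.vert_symm_apply, e]), Equiv.apply_symm_apply]

theorem rot_symm_eq {h : H} (e : ε' (G.vert h) ≠ ε (G.vert h)) :
    (G.rot ε').symm h = G.rot ε h := by
  have hs := isRotation_rot (G := G) ε
  rw [Equiv.symm_apply_eq, rot_eq_symm (by rwa [hs.vert_apply]), Equiv.symm_apply_apply]

variable [Fintype V] [Fintype H]

theorem sum_wedge_eq_zero (hE : G.Exact (G.rot ε)) (hE' : G.Exact (G.rot ε')) {x y : H → ZMod 2}
    (hx : G.IsCycle x) (hy : G.IsCycle y) :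
    ∑ v, (if ε' v = ε v then 0 else 1) *
      (x (G.halfAt v) * y (G.rot ε (G.halfAt v)) + x (G.rot ε (G.halfAt v)) * y (G.halfAt v)) =
      0 := by
  have hs := isRotation_rot (G := G) ε
  obtain ⟨a, ha, hb⟩ := hE x hx
  obtain ⟨a', ha', hb'⟩ := hE' x hx
  have h0 : ∑ h, (a h + a' h) * y h = 0 := by
    rw [G.sum_half_edge]
    refine Finset.sum_eq_zero fun e _ => ?_
    rw [hy.flip]
    have h1 := ha e.out
    have h2 := ha' e.out
    generalize a e.out = p at *
    generalize a (G.flip e.out) = p' at *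
    generalize a' e.out = q at *
    generalize a' (G.flip e.out) = q' at *
    generalize y e.out = z
    generalize x e.out = w at *
    subst h1
    revert p p' q q' z
    decide
  rw [hs.sum_half] at h0
  refine Eq.trans (Finset.sum_congr rfl fun v _ => ?_) h0
  have hv := G.vert_halfAt v
  set h := G.halfAt v
  have r0 := ha h
  have r1 := ha (G.rot ε h)
  have r2 := ha (G.rot ε (G.rot ε h))
  have r0' := ha' h
  have r1' := ha' (G.rot ε h)
  have r2' := ha' (G.rot ε (G.rot ε h))
  have sy := hy.sum_rotation hs h
  simp only [hb, Equiv.symm_apply_apply, hs.symm_apply h] at r0 r1 r2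
  by_cases e : ε' v = ε v
  · have e' : ∀ g, G.vert g = v → (G.rot ε').symm g = (G.rot ε).symm g := fun g hg =>
      rot_symm_congr (by rwa [hg])
    rw [hb', e' _ hv, hs.symm_apply] at r0'
    rw [hb', e' _ (by rw [hs.vert_apply, hv]), Equiv.symm_apply_apply] at r1'
    rw [hb', e' _ (by rw [hs.vert_apply, hs.vert_apply, hv]), Equiv.symm_apply_apply] at r2'
    rw [if_pos e]
    clear_value h
    generalize G.rot ε (G.rot ε h) = h2 at *
    generalize G.rot ε h = h1 at *
    grind
  · have e' : ∀ g, G.vert g = v → (G.rot ε').symm g = G.rot ε g := fun g hg =>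
      rot_symm_eq (by rwa [hg])
    rw [hb', e' _ hv] at r0'
    rw [hb', e' _ (by rw [hs.vert_apply, hv])] at r1'
    rw [hb', e' _ (by rw [hs.vert_apply, hs.vert_apply, hv]), hs.apply_three] at r2'
    rw [if_neg e, one_mul]
    clear_value h
    generalize G.rot ε (G.rot ε h) = h2 at *
    generalize G.rot ε h = h1 at *
    grind

theorem prod_eq_prod_of_exact (hG : G.TwoConnected) (hE : G.Exact (G.rot ε))
    (hE' : G.Exact (G.rot ε')) : ∏ v, ε v = ∏ v, ε' v := by
  classical
  have hs := isRotation_rot (G := G) ε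
  let F := PermCycles (G.facePerm (G.rot ε))
  let n := Fintype.card F
  let c : H → Fin n := fun h => Fintype.equivFin F (G.faceOf (G.rot ε) h)
  have hc : ∀ h, c (G.flip h) = c ((G.rot ε).symm h) := fun h =>
    congrArg (Fintype.equivFin F) (TrivalentGraph.faceOf_flip h)
  have hne : ∀ h, c h ≠ c ((G.rot ε).symm h) := fun h e =>
    hE.faceOf_ne hs hG h ((Fintype.equivFin F).injective e)
  let b : Fin n → H → ZMod 2 := fun i h => if c h = i then 1 else 0
  let x : Fin n → H → ZMod 2 := fun i h => b i h + b i (G.flip h)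
  have hx : ∀ i, G.IsCycle (x i) := fun i =>
    TrivalentGraph.isCycle_boundary hs fun h => by simp only [b, hc]
  have hx' : ∀ i h, x i h = (if c h = i then 1 else 0) +
      (if c ((G.rot ε).symm h) = i then 1 else 0) := fun i h => by simp only [x, b, hc]
  have key : ∑ v, (if ε' v = ε v then 0 else 1 : ZMod 2) = 0 := by
    have h1 : ∑ i, ∑ j, (if i < j then ∑ v, (if ε' v = ε v then 0 else 1) *
        (x i (G.halfAt v) * x j (G.rot ε (G.halfAt v)) +
          x i (G.rot ε (G.halfAt v)) * x j (G.halfAt v)) else 0) = 0 :=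
      Finset.sum_eq_zero fun i _ => Finset.sum_eq_zero fun j _ => by
        rw [sum_wedge_eq_zero hE hE' (hx i) (hx j), ite_self]
    refine Eq.trans ?_ h1
    have h2 : ∀ v, (∑ i, ∑ j, if i < j then (x i (G.halfAt v) * x j (G.rot ε (G.halfAt v)) +
          x i (G.rot ε (G.halfAt v)) * x j (G.halfAt v)) else 0) = 1 := fun v => by
      simp only [hx', Equiv.symm_apply_apply]
      have h3 := hne (G.halfAt v)
      have h4 := hne (G.rot ε (G.halfAt v))
      have h5 := hne (G.rot ε (G.rot ε (G.halfAt v)))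
      rw [Equiv.symm_apply_apply] at h4 h5
      rw [hs.symm_apply] at h3 ⊢
      exact sum_sum_lt_wedge h4.symm h5.symm h3
    have h6 : ∀ v, (if ε' v = ε v then 0 else 1 : ZMod 2) = ∑ i, ∑ j, if i < j then
        (if ε' v = ε v then 0 else 1) * (x i (G.halfAt v) * x j (G.rot ε (G.halfAt v)) +
          x i (G.rot ε (G.halfAt v)) * x j (G.halfAt v)) else 0 := fun v => by
      refine (mul_one _).symm.trans ((congrArg _ (h2 v).symm).trans ?_)
      rw [Finset.mul_sum]
      refine Finset.sum_congr rfl fun i _ => ?_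
      rw [Finset.mul_sum]
      refine Finset.sum_congr rfl fun j _ => ?_
      rw [mul_ite, mul_zero]
    rw [Finset.sum_congr rfl fun v _ => h6 v, Finset.sum_comm]
    refine Finset.sum_congr rfl fun i _ => ?_
    rw [Finset.sum_comm]
    refine Finset.sum_congr rfl fun j _ => ?_
    by_cases hij : i < j <;> simp [hij]
  have h7 : Even (Finset.univ.filter fun v => ¬ ε' v = ε v).card := by
    rw [← ZMod.natCast_eq_zero_iff_even, ← key, Finset.sum_ite]
    simp
  have h8 : ∏ v, ε' v * ε v = 1 := by
    have : ∀ v, ε' v * ε v = if ε' v = ε v then 1 else -1 := fun v => by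
      rcases Int.units_eq_one_or (ε v) with e | e <;>
        rcases Int.units_eq_one_or (ε' v) with e' | e' <;> rw [e, e'] <;> decide
    rw [Finset.prod_congr rfl fun v _ => this v, Finset.prod_ite, Finset.prod_const_one, one_mul,
      Finset.prod_const, h7.neg_one_pow]
  rw [Finset.prod_mul_distrib] at h8
  rw [eq_inv_of_mul_eq_one_right h8, Int.units_inv_eq_self]

/-- A half-edge of a bridge is in no cycle modulo 2. -/
theorem _root_.TrivalentGraph.IsCycle.eq_zero_of_cut {G : TrivalentGraph V H} {s : Equiv.Perm H}
    (hs : G.IsRotation s) {c : V → ZMod 2} {h₀ : H}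
    (hc : ∀ h, h ≠ h₀ → h ≠ G.flip h₀ → c (G.vert h) = c (G.vert (G.flip h)))
    (hc₀ : c (G.vert h₀) ≠ c (G.vert (G.flip h₀))) {x : H → ZMod 2} (hx : G.IsCycle x) :
    x h₀ = 0 := by
  classical
  have hx' : ∀ h, x (G.edgeOf h).out = x h := fun h => by
    rcases TrivalentGraph.out_edgeOf (G := G) h with e | e <;> rw [e]
    exact hx.flip h
  have h1 : G.boundary s (fun e => x e.out) = 0 := by
    rw [TrivalentGraph.boundary_eq_zero_iff hs]
    simpa only [hx'] using hx
  have h2 := TrivalentGraph.boundary_adjoint hs (fun e => x e.out) c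
  rw [h1, dotProduct_zero] at h2
  have h3 : G.coboundary c = Pi.single (G.edgeOf h₀) 1 := by
    funext e
    rw [← TrivalentGraph.edgeOf_out e, TrivalentGraph.coboundary_edgeOf]
    by_cases he : G.edgeOf h₀ = G.edgeOf e.out
    · rw [← he, Pi.single_eq_same, ← TrivalentGraph.coboundary_edgeOf, ← he,
        TrivalentGraph.coboundary_edgeOf]
      exact Fin.eq_one_of_ne_zero _ fun h => hc₀ (CharTwo.add_eq_zero.1 h)
    · rw [Pi.single_eq_of_ne (Ne.symm he), hc, CharTwo.add_self_eq_zero]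
      · exact fun h => he (TrivalentGraph.edgeOf_eq_iff.2 (Or.inl h))
      · exact fun h => he (TrivalentGraph.edgeOf_eq_iff.2 (Or.inr h))
  rw [h3, single_dotProduct, one_mul, hx'] at h2
  exact h2.symm

open Classical in
/-- Reversing the orientation at an end of a bridge does not change the genus. -/
theorem exact_update {c : V → ZMod 2} {h₀ : H}
    (hc : ∀ h, h ≠ h₀ → h ≠ G.flip h₀ → c (G.vert h) = c (G.vert (G.flip h)))
    (hc₀ : c (G.vert h₀) ≠ c (G.vert (G.flip h₀))) (hE : G.Exact (G.rot ε)) :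
    G.Exact (G.rot (Function.update ε (G.vert h₀) (-ε (G.vert h₀)))) := by
  set ε' := Function.update ε (G.vert h₀) (-ε (G.vert h₀)) with hε'
  have hs := isRotation_rot (G := G) ε
  intro x hx
  obtain ⟨a, ha, hb⟩ := hE x hx
  have hx0 := hx.eq_zero_of_cut hs hc hc₀
  set h₁ := G.rot ε h₀ with hh₁
  set h₂ := G.rot ε h₁ with hh₂
  have v1 : G.vert h₁ = G.vert h₀ := hs.vert_apply _
  have v2 : G.vert h₂ = G.vert h₀ := (hs.vert_apply _).trans v1
  have h20 : G.rot ε h₂ = h₀ := hs.apply_three _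
  have r0 := ha h₀
  have r1 := ha h₁
  have r2 := ha h₂
  rw [hb, Equiv.symm_apply_eq _ |>.2 h20.symm] at r0
  rw [hb, Equiv.symm_apply_eq _ |>.2 hh₁] at r1
  rw [hb, Equiv.symm_apply_eq _ |>.2 hh₂] at r2
  have n1 : h₁ ≠ h₀ := hs.apply_ne _
  have n2 : h₂ ≠ h₀ := hs.apply_apply_ne _
  have nf : ∀ h, c (G.vert h) = c (G.vert h₀) → h ≠ G.flip h₀ := by
    rintro _ e rfl
    exact hc₀ e.symm
  let d : H → ZMod 2 := fun h =>
    if c (G.vert h) = c (G.vert h₀) ∧ h ≠ h₀ ∧ h ≠ G.flip h₀ then x h₁ else 0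
  have d0 : d h₀ = 0 := if_neg (by simp)
  have d1 : d h₁ = x h₁ := if_pos ⟨by rw [v1], n1, nf _ (by rw [v1])⟩
  have d2 : d h₂ = x h₁ := if_pos ⟨by rw [v2], n2, nf _ (by rw [v2])⟩
  have dflip : ∀ h, d (G.flip h) = d h := by
    intro h
    by_cases e : h = h₀ ∨ h = G.flip h₀
    · rcases e with rfl | rfl <;> simp [d, G.flip_flip]
    · have e1 : ¬ (G.flip h = h₀ ∨ G.flip h = G.flip h₀) := by
        rintro (e1 | e1)
        · exact e (Or.inr (by rw [← e1, G.flip_flip]))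
        · exact e (Or.inl (G.flip.injective e1))
      rw [not_or] at e e1
      simp only [d, hc h e.1 e.2, e, e1, ne_eq, not_false_eq_true, and_self, and_true]
  refine ⟨fun h => a h + d h, fun h => ?_, fun h => ?_⟩
  · dsimp only
    rw [dflip, ← ha h]
    linear_combination d h * (CharTwo.two_eq_zero : (2 : ZMod 2) = 0)
  · dsimp only
    rw [dflip, hb]
    by_cases hv : G.vert h = G.vert h₀
    · rw [rot_symm_eq (ε := ε) (ε' := ε')
        (by rw [hv, hε', Function.update_self]; exact units_ne_neg_self _ |>.symm)]
      rcases hs.vert_eq_iff.1 hv with rfl | rfl | rfl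
      · rw [Equiv.symm_apply_eq _ |>.2 h20.symm, ← hh₁, d0, d1]
        grind
      · rw [← hh₁, Equiv.symm_apply_apply, ← hh₂, d1, d2]
        grind
      · rw [← hh₁, ← hh₂, Equiv.symm_apply_eq _ |>.2 hh₂, h20, d0, d2]
        grind
    · rw [rot_symm_congr (ε := ε) (ε' := ε') (by rw [hε', Function.update_of_ne hv])]
      congr 1
      simp only [d, hs.vert_symm_apply]
      have e1 : h ≠ h₀ := by rintro rfl; exact hv rfl
      have e2 : (G.rot ε).symm h ≠ h₀ := by
        rintro e
        exact hv (by rw [← e, hs.vert_symm_apply])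
      by_cases e : c (G.vert h) = c (G.vert h₀)
      · simp [e, e1, e2, nf h e, nf ((G.rot ε).symm h) (by rw [hs.vert_symm_apply, e])]
      · simp [e]

open Classical in
theorem sum_prod_exact_eq_zero (hG : G.Connected) (hG' : ¬ G.TwoConnected) :
    ∑ ε ∈ Finset.univ.filter (fun ε : V → ℤˣ => G.Exact (G.rot ε)), ((∏ v, ε v : ℤˣ) : ℤ) = 0 := by
  have : Nonempty V := hG.nonempty
  have h1 : ∃ h₀, ¬ (G.graphDeleting {h₀, G.flip h₀}).Connected := by
    by_contra h
    push Not at h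
    exact hG' ⟨hG, h⟩
  obtain ⟨h₀, hh⟩ := h1
  obtain ⟨c, hc, v, w, hvw⟩ := TrivalentGraph.exists_cut hh
  have hc' : ∀ h, h ≠ h₀ → h ≠ G.flip h₀ → c (G.vert h) = c (G.vert (G.flip h)) := by
    intro h e1 e2
    refine hc h (by simp [e1, e2]) ?_
    rintro (e | e)
    · exact e2 (by rw [← e, G.flip_flip])
    · exact e1 (G.flip.injective e)
  have hc₀ : c (G.vert h₀) ≠ c (G.vert (G.flip h₀)) := fun e => hvw <|
    TrivalentGraph.eq_of_connected hG c (fun h _ _ => by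
      by_cases e1 : h = h₀
      · rw [e1, e]
      · by_cases e2 : h = G.flip h₀
        · rw [e2, G.flip_flip, e]
        · exact hc' h e1 e2) v w
  refine Finset.sum_involution (fun ε _ => Function.update ε (G.vert h₀) (-ε (G.vert h₀)))
    (fun ε _ => ?_) (fun ε _ _ e => ?_) (fun ε hε => ?_) (fun ε _ => ?_)
  · have : ∏ v, Function.update ε (G.vert h₀) (-ε (G.vert h₀)) v = -∏ v, ε v := by
      rw [Finset.prod_update_of_mem (Finset.mem_univ _), neg_mul,
        ← Finset.prod_erase_mul _ _ (Finset.mem_univ (G.vert h₀)), mul_comm,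
        Finset.sdiff_singleton_eq_erase]
    rw [this]
    simp
  · have := congrFun e (G.vert h₀)
    rw [Function.update_self] at this
    exact units_ne_neg_self _ this.symm
  · simp only [Finset.mem_filter, Finset.mem_univ, true_and] at hε ⊢
    exact exact_update hc' hc₀ hε
  · simp

end OrientedTrivalentGraph

/-- Functions on a three-element set as triples. -/
def finThreeArrowEquiv (I : Type*) : (Fin 3 → I) ≃ I × I × I where
  toFun q := (q 0, q 1, q 2)
  invFun p := ![p.1, p.2.1, p.2.2]
  left_inv q := by
    funext i
    fin_cases i <;> rfl
  right_inv _ := rfl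

section StateSum

variable {V H : Type*} [Fintype H] {I J K : Type*} [Fintype I] [Fintype J] [Field K]

open Classical in
theorem TrivalentGraph.IsRotation.prod_sum_half [Fintype V] {G : TrivalentGraph V H}
    {s : Equiv.Perm H}
    (hs : G.IsRotation s) (g : V → I → I → I → K) :
    ∏ v, ∑ i, ∑ j, ∑ k, g v i j k = ∑ m : H → I, ∏ v,
      g v (m (G.halfAt v)) (m (s (G.halfAt v))) (m (s (s (G.halfAt v)))) := by
  have h1 : ∀ v, ∑ i, ∑ j, ∑ k, g v i j k = ∑ q : Fin 3 → I, g v (q 0) (q 1) (q 2) := by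
    intro v
    refine Eq.trans ?_ (Fintype.sum_equiv (finThreeArrowEquiv I) _
      (fun p => g v p.1 p.2.1 p.2.2) fun _ => rfl).symm
    simp only [Fintype.sum_prod_type]
  simp only [h1, Finset.prod_univ_sum, Fintype.piFinset_univ]
  refine Fintype.sum_equiv
    ((Equiv.curry V (Fin 3) I).symm.trans (hs.equivHalf.arrowCongr (Equiv.refl I))) _ _ fun q => ?_
  refine Finset.prod_congr rfl fun v _ => ?_
  have h2 : ∀ i : Fin 3, ((Equiv.curry V (Fin 3) I).symm.trans
      (hs.equivHalf.arrowCongr (Equiv.refl I))) q ((s ^ (i : ℕ)) (G.halfAt v)) = q v i := by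
    intro i
    have : (s ^ (i : ℕ)) (G.halfAt v) = hs.equivHalf (v, i) := rfl
    rw [this]
    simp [Equiv.arrowCongr]
  rw [← h2 0, ← h2 1, ← h2 2]
  rfl

open Classical in
theorem TrivalentGraph.prod_sum_half_edge (G : TrivalentGraph V H) (g : G.Edge → I → I → K) :
    ∏ e, ∑ i, ∑ j, g e i j = ∑ m : H → I, ∏ e : G.Edge, g e (m e.out) (m (G.flip e.out)) := by
  have h1 : ∀ e, ∑ i, ∑ j, g e i j = ∑ q : Fin 2 → I, g e (q 0) (q 1) := by
    intro e
    refine Eq.trans ?_ (Fintype.sum_equiv (finTwoArrowEquiv I) _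
      (fun p => g e p.1 p.2) fun _ => rfl).symm
    rw [Fintype.sum_prod_type]
  simp only [h1, Finset.prod_univ_sum, Fintype.piFinset_univ]
  refine Fintype.sum_equiv
    ((Equiv.curry G.Edge (Fin 2) I).symm.trans (G.equivHalfEdge.arrowCongr (Equiv.refl I)))
    _ _ fun q => ?_
  refine Finset.prod_congr rfl fun v _ => ?_
  have h2 : ∀ i : Fin 2, ((Equiv.curry G.Edge (Fin 2) I).symm.trans
      (G.equivHalfEdge.arrowCongr (Equiv.refl I))) q ((G.flip ^ (i : ℕ)) v.out) = q v i := by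
    intro i
    have : (G.flip ^ (i : ℕ)) v.out = G.equivHalfEdge (v, i) := rfl
    rw [this]
    simp [Equiv.arrowCongr]
  rw [← h2 0, ← h2 1]
  rfl

open Classical in
/-- The contraction along `G` of a tensor `T` at the vertices with a tensor `Q` at the edges. -/
noncomputable def stateSum [Fintype V] (G : OrientedTrivalentGraph V H) (T : I → I → I → K)
    (Q : I → I → K) : K :=
  ∑ m : H → I, (∏ v : V, T (m (G.halfAt v)) (m (G.next (G.halfAt v)))
    (m (G.next (G.next (G.halfAt v))))) * ∏ e : G.Edge, Q (m e.out) (m (G.flip e.out))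

theorem lieWeight_eq_stateSum [Fintype V] {L : Type*} [LieRing L] [LieAlgebra K L]
    (B : LinearMap.BilinForm K L)
    (b : Module.Basis I K L) (G : OrientedTrivalentGraph V H) :
    lieWeight B b G = stateSum G (structureConst B b) (inverseMetric B b) := rfl

/-- A linear substitution can be moved from the vertices to the edges. -/
theorem stateSum_subst [Fintype V] (G : OrientedTrivalentGraph V H) (T : I → I → I → K)
    (Q : J → J → K) (M : J → I → K) :
    stateSum G (fun a b c => ∑ i, ∑ j, ∑ k, M a i * M b j * M c k * T i j k) Q =
      stateSum G T (fun i j => ∑ a, ∑ b, M a i * M b j * Q a b) := by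
  classical
  unfold stateSum
  have h1 : ∀ a : H → J, (∏ v : V, ∑ i, ∑ j, ∑ k, M (a (G.halfAt v)) i *
      M (a (G.next (G.halfAt v))) j * M (a (G.next (G.next (G.halfAt v)))) k * T i j k) =
      ∑ m : H → I, (∏ h, M (a h) (m h)) * ∏ v : V, T (m (G.halfAt v)) (m (G.next (G.halfAt v)))
        (m (G.next (G.next (G.halfAt v)))) := fun a => by
    rw [G.isRotation_next.prod_sum_half fun v i j k => M (a (G.halfAt v)) i *
      M (a (G.next (G.halfAt v))) j * M (a (G.next (G.next (G.halfAt v)))) k * T i j k]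
    refine Finset.sum_congr rfl fun m _ => ?_
    rw [G.isRotation_next.prod_half, ← Finset.prod_mul_distrib]
  have h2 : ∀ m : H → I, (∏ e : G.Edge, ∑ a, ∑ b, M a (m e.out) * M b (m (G.flip e.out)) * Q a b) =
      ∑ a : H → J, (∏ h, M (a h) (m h)) * ∏ e : G.Edge, Q (a e.out) (a (G.flip e.out)) :=
      fun m => by
    rw [G.prod_sum_half_edge fun e a b => M a (m e.out) * M b (m (G.flip e.out)) * Q a b]
    refine Finset.sum_congr rfl fun a _ => ?_
    rw [G.prod_half_edge, ← Finset.prod_mul_distrib]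
  simp only [h1, h2, Finset.sum_mul, Finset.mul_sum]
  rw [Finset.sum_comm]
  refine Finset.sum_congr rfl fun m _ => Finset.sum_congr rfl fun a _ => ?_
  ring

end StateSum

section Matrices

variable {K : Type*} [Field K] {N : ℕ}

/-- The trilinear form `tr (x [y, z])` on matrix units. -/
def glVertex (K : Type*) [Field K] (N : ℕ) (p q r : Fin N × Fin N) : K :=
  (if p.2 = q.1 then 1 else 0) * (if q.2 = r.1 then 1 else 0) * (if r.2 = p.1 then 1 else 0) -
    (if p.2 = r.1 then 1 else 0) * (if r.2 = q.1 then 1 else 0) * (if q.2 = p.1 then 1 else 0)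

/-- The inverse of the trace form on matrix units. -/
def glEdge (K : Type*) [Field K] (N : ℕ) (p q : Fin N × Fin N) : K :=
  (if p.2 = q.1 then 1 else 0) * (if p.1 = q.2 then 1 else 0)

/-- The coefficients of the projection of matrices onto traceless matrices. -/
def slProj (K : Type*) [Field K] (N : ℕ) (p q : Fin N × Fin N) : K :=
  (if p = q then 1 else 0) -
    (N : K)⁻¹ * ((if p.1 = p.2 then 1 else 0) * (if q.1 = q.2 then 1 else 0))

theorem sum_glVertex (X Y Z : Matrix (Fin N) (Fin N) K) :
    ∑ p : Fin N × Fin N, ∑ q : Fin N × Fin N, ∑ r : Fin N × Fin N,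
      X p.1 p.2 * Y q.1 q.2 * Z r.1 r.2 * glVertex K N p q r = (X * ⁅Y, Z⁆).trace := by
  rw [Ring.lie_def, mul_sub, Matrix.trace_sub]
  simp only [glVertex, mul_sub, Finset.sum_sub_distrib]
  congr 1
  · simp only [Fintype.sum_prod_type, Matrix.trace, Matrix.diag, Matrix.mul_apply, Finset.mul_sum]
    simp [mul_ite, ← mul_assoc]
  · simp only [Fintype.sum_prod_type, Matrix.trace, Matrix.diag, Matrix.mul_apply, Finset.mul_sum]
    simp [mul_ite, ← mul_assoc]
    refine Finset.sum_congr rfl fun i _ => ?_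
    refine Finset.sum_congr rfl fun j _ => Finset.sum_congr rfl fun k _ => ?_
    ring

theorem single_apply_prod (p q : Fin N × Fin N) :
    Matrix.single p.1 p.2 (1 : K) q.1 q.2 = if p = q then 1 else 0 := by
  simp only [Matrix.single_apply, Prod.ext_iff]

theorem glVertex_eq_trace (p q r : Fin N × Fin N) :
    glVertex K N p q r = (Matrix.single p.1 p.2 (1 : K) *
      ⁅Matrix.single q.1 q.2 (1 : K), Matrix.single r.1 r.2 (1 : K)⁆).trace := by
  rw [← sum_glVertex]
  simp [single_apply_prod]

/-- The matrix with coefficients `slProj K N p`. -/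
def slProjMatrix (K : Type*) [Field K] (N : ℕ) (p : Fin N × Fin N) : Matrix (Fin N) (Fin N) K :=
  Matrix.of fun i j => slProj K N p (i, j)

theorem slProjMatrix_eq (p : Fin N × Fin N) : slProjMatrix K N p =
    Matrix.single p.1 p.2 (1 : K) - ((N : K)⁻¹ * if p.1 = p.2 then 1 else 0) • 1 := by
  ext i j
  rw [Matrix.sub_apply, Matrix.smul_apply, Matrix.one_apply]
  simp only [slProjMatrix, slProj, Matrix.of_apply, Matrix.single_apply, Prod.ext_iff, smul_eq_mul,
    mul_assoc]

theorem sum_slProj_glVertex (p q r : Fin N × Fin N) :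
    ∑ i, ∑ j, ∑ k, slProj K N p i * slProj K N q j * slProj K N r k * glVertex K N i j k =
      glVertex K N p q r := by
  refine (sum_glVertex (slProjMatrix K N p) (slProjMatrix K N q) (slProjMatrix K N r)).trans ?_
  rw [glVertex_eq_trace]
  simp only [slProjMatrix_eq, Ring.lie_def]
  simp only [sub_mul, mul_sub, Matrix.trace_sub, smul_mul_assoc, mul_smul_comm, one_mul, mul_one,
    Matrix.trace_smul]
  rw [Matrix.trace_mul_comm (Matrix.single q.1 q.2 1) (Matrix.single r.1 r.2 1)]
  ring

theorem slProj_comm (p q : Fin N × Fin N) : slProj K N p q = slProj K N q p := by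
  simp only [slProj, eq_comm (a := p) (b := q)]
  ring

theorem sum_slProj_mul (p : Fin N × Fin N) (f : Fin N × Fin N → K) :
    ∑ i, slProj K N p i * f i = f p - (N : K)⁻¹ * (if p.1 = p.2 then 1 else 0) * ∑ k, f (k, k) := by
  simp only [slProj, sub_mul, Finset.sum_sub_distrib, ite_mul, one_mul, zero_mul,
    Finset.sum_ite_eq, Finset.mem_univ, if_true]
  congr 1
  rw [Fintype.sum_prod_type, Finset.mul_sum]
  refine Finset.sum_congr rfl fun i _ => ?_
  rw [Finset.sum_eq_single i]
  · simp
  · intro j _ hj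
    simp [hj.symm]
  · simp

theorem sum_slProj_glEdge [CharZero K] (hN : 1 ≤ N) (p q : Fin N × Fin N) :
    ∑ i, ∑ j, slProj K N i p * slProj K N j q * glEdge K N i j = slProj K N p.swap q := by
  have hN' : (N : K) ≠ 0 := by exact_mod_cast (by omega : N ≠ 0)
  have h1 : ∀ i j, glEdge K N i j = if j = i.swap then 1 else 0 := by
    rintro ⟨i, i'⟩ ⟨j, j'⟩
    simp only [glEdge, Prod.swap, Prod.ext_iff, ite_and, mul_ite, mul_one, mul_zero]
    by_cases e : i' = j <;> by_cases e' : i = j' <;> simp [e, e', eq_comm]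
  simp only [h1, mul_ite, mul_one, mul_zero, Finset.sum_ite_eq', Finset.mem_univ, if_true]
  simp only [slProj_comm _ p]
  rw [sum_slProj_mul]
  have h2 : ∑ k, slProj K N (Prod.swap (k, k)) q = 0 := by
    by_cases e : q.1 = q.2 <;> simp [slProj, e, Prod.ext_iff, hN']
  rw [h2, mul_zero, sub_zero]

/-- The Casimir element of `sl(N)`. -/
theorem sum_inverseMetric [CharZero K] (hN : 1 ≤ N) {ι : Type*} [Fintype ι]
    (b : Module.Basis ι K (LieAlgebra.SpecialLinear.sl (Fin N) K)) (p q : Fin N × Fin N) :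
    ∑ i, ∑ j, (b i : Matrix (Fin N) (Fin N) K) p.1 p.2 * (b j : Matrix (Fin N) (Fin N) K) q.1 q.2 *
      inverseMetric (slTraceForm K N) b i j = slProj K N p.swap q := by
  classical
  have hN' : (N : K) ≠ 0 := by exact_mod_cast (by omega : N ≠ 0)
  have hmem : ∀ X : Matrix (Fin N) (Fin N) K,
      X - ((N : K)⁻¹ * X.trace) • 1 ∈ LieAlgebra.SpecialLinear.sl (Fin N) K := fun X => by
    change (X - ((N : K)⁻¹ * X.trace) • 1).trace = 0
    rw [Matrix.trace_sub, Matrix.trace_smul, Matrix.trace_one, Fintype.card_fin, smul_eq_mul]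
    field_simp
    simp
  have htr : ∀ (x : LieAlgebra.SpecialLinear.sl (Fin N) K) (X : Matrix (Fin N) (Fin N) K),
      slTraceForm K N x ⟨_, hmem X⟩ = (x.1 * X).trace := fun x X => by
    have hx : Matrix.trace x.1 = 0 := x.2
    change (x.1 * (X - ((N : K)⁻¹ * X.trace) • 1)).trace = _
    rw [mul_sub, Matrix.trace_sub, mul_smul_comm, mul_one, Matrix.trace_smul, hx, smul_zero,
      sub_zero]
  have hsymm : ∀ x y, slTraceForm K N x y = slTraceForm K N y x := fun x y =>
    Matrix.trace_mul_comm x.1 y.1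
  have hsep : ∀ x, (∀ y, slTraceForm K N x y = 0) → x = 0 := fun x hx => by
    refine Subtype.ext ?_
    ext i j
    have := hx ⟨_, hmem (Matrix.single j i 1)⟩
    rw [htr, Matrix.trace_mul_single] at this
    simpa using this
  have hnd : (slTraceForm K N).Nondegenerate :=
    ⟨hsep, fun y hy => hsep y fun x => by rw [hsymm, hy]⟩
  have hdet := (LinearMap.BilinForm.nondegenerate_iff_det_ne_zero b).1 hnd
  have ht : inverseMetric (slTraceForm K N) b =
      (LinearMap.BilinForm.toMatrix b (slTraceForm K N))⁻¹ := by
    unfold inverseMetric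
    congr
    ext i j
    rw [LinearMap.BilinForm.toMatrix_apply, Matrix.of_apply]
  have hinv := Matrix.nonsing_inv_mul _ (isUnit_iff_ne_zero.2 hdet)
  rw [← ht] at hinv
  set t := inverseMetric (slTraceForm K N) b with ht'
  have hdual : ∀ x, ∑ i, ∑ j, (t i j * slTraceForm K N (b j) x) • b i = x := fun x => by
    have h1 : ∀ j, slTraceForm K N (b j) x =
        ∑ k, LinearMap.BilinForm.toMatrix b (slTraceForm K N) j k * b.repr x k := fun j => by
      conv_lhs => rw [← b.sum_repr x]
      rw [map_sum]
      refine Finset.sum_congr rfl fun k _ => ?_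
      rw [map_smul, LinearMap.BilinForm.toMatrix_apply, smul_eq_mul, mul_comm]
    conv_rhs => rw [← b.sum_repr x]
    refine Finset.sum_congr rfl fun i _ => ?_
    rw [← Finset.sum_smul]
    congr 1
    simp only [h1, Finset.mul_sum, ← mul_assoc]
    rw [Finset.sum_comm]
    simp only [← Finset.sum_mul, ← Matrix.mul_apply, hinv, Matrix.one_apply, ite_mul, one_mul,
      zero_mul, Finset.sum_ite_eq, Finset.mem_univ, if_true]
  have h2 := congrArg (fun y : LieAlgebra.SpecialLinear.sl (Fin N) K =>
    (y : Matrix (Fin N) (Fin N) K) p.1 p.2) (hdual ⟨_, hmem (Matrix.single q.2 q.1 1)⟩)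
  simp only [htr, Matrix.trace_mul_single] at h2
  simp only [AddSubmonoidClass.coe_finsetSum, Matrix.sum_apply] at h2
  refine Eq.trans ?_ (h2.trans ?_)
  · refine Finset.sum_congr rfl fun i _ => Finset.sum_congr rfl fun j _ => ?_
    simp
    ring
  · have h3 : (Matrix.single q.2 q.1 (1 : K)).trace = if q.1 = q.2 then 1 else 0 := by
      split_ifs with e
      · rw [e, Matrix.trace_single_eq_same]
      · exact Matrix.trace_single_eq_of_ne _ _ _ (Ne.symm e)
    rw [h3, Matrix.sub_apply, Matrix.smul_apply, Matrix.one_apply, Matrix.single_apply, slProj]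
    simp only [Prod.ext_iff, Prod.fst_swap, Prod.snd_swap, eq_comm (a := p.2), smul_eq_mul]
    have h4 : (p.1 = q.2) = (q.2 = p.1) := propext eq_comm
    have h5 : (p.1 = p.2) = (p.2 = p.1) := propext eq_comm
    simp only [h4, and_comm (a := q.1 = p.2)]
    ring_nf

theorem structureConst_sl {ι : Type*} [Fintype ι]
    (b : Module.Basis ι K (LieAlgebra.SpecialLinear.sl (Fin N) K)) (a₁ a₂ a₃ : ι) :
    structureConst (slTraceForm K N) b a₁ a₂ a₃ = ∑ i : Fin N × Fin N, ∑ j : Fin N × Fin N,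
      ∑ k : Fin N × Fin N, (b a₁ : Matrix (Fin N) (Fin N) K) i.1 i.2 *
      (b a₂ : Matrix (Fin N) (Fin N) K) j.1 j.2 * (b a₃ : Matrix (Fin N) (Fin N) K) k.1 k.2 *
      glVertex K N i j k := by
  rw [sum_glVertex]
  rfl

/-- The weight systems of `sl(N)` and `gl(N)` agree on trivalent graphs. -/
theorem lieWeight_sl [CharZero K] (hN : 1 ≤ N) {V H ι : Type*} [Fintype V] [Fintype H] [Fintype ι]
    (b : Module.Basis ι K (LieAlgebra.SpecialLinear.sl (Fin N) K))
    (G : OrientedTrivalentGraph V H) :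
    lieWeight (slTraceForm K N) b G = stateSum G (glVertex K N) (glEdge K N) := by
  have h1 : structureConst (slTraceForm K N) b = fun a₁ a₂ a₃ => ∑ i : Fin N × Fin N,
      ∑ j : Fin N × Fin N, ∑ k : Fin N × Fin N, (b a₁ : Matrix (Fin N) (Fin N) K) i.1 i.2 *
      (b a₂ : Matrix (Fin N) (Fin N) K) j.1 j.2 * (b a₃ : Matrix (Fin N) (Fin N) K) k.1 k.2 *
      glVertex K N i j k := by
    funext a₁ a₂ a₃
    exact structureConst_sl b a₁ a₂ a₃
  rw [lieWeight_eq_stateSum, h1, stateSum_subst G (glVertex K N)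
    (inverseMetric (slTraceForm K N) b)
    fun a (i : Fin N × Fin N) => (b a : Matrix (Fin N) (Fin N) K) i.1 i.2]
  have h2 := stateSum_subst G (glVertex K N) (glEdge K N) (slProj K N)
  simp only [sum_slProj_glVertex, sum_slProj_glEdge hN] at h2
  simp only [sum_inverseMetric hN]
  exact h2.symm

end Matrices

/-- The labellings of the half-edges by pairs of colours that are compatible with a rotation
system are the colourings of its faces. -/
theorem TrivalentGraph.IsRotation.card_labellings {V H : Type*} [Finite H]
    {G : TrivalentGraph V H} {s : Equiv.Perm H} (N : ℕ) :
    Nat.card {m : H → Fin N × Fin N // (∀ h, (m h).2 = (m (s h)).1) ∧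
      ∀ h, (m h).1 = (m (G.flip h)).2} = N ^ G.numFaces s := by
  let f : (PermCycles (G.facePerm s) → Fin N) → {m : H → Fin N × Fin N //
      (∀ h, (m h).2 = (m (s h)).1) ∧ ∀ h, (m h).1 = (m (G.flip h)).2} := fun b =>
    ⟨fun h => (b (G.faceOf s (G.flip h)), b (G.faceOf s h)), fun h => by
      simp [faceOf_flip], fun h => rfl⟩
  have hf : Function.Bijective f := by
    constructor
    · intro b b' e
      funext x
      induction x using Quotient.inductionOn with | _ x
      exact congrArg Prod.snd (congrFun (congrArg Subtype.val e) x)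
    · rintro ⟨m, h1, h2⟩
      have h3 : ∀ h, (m (G.flip h)).2 = (m (s.symm h)).2 := fun h => by
        rw [← h2, h1, Equiv.apply_symm_apply]
      obtain ⟨b, hb⟩ := exists_faceOf_of_invariant (a := fun h => (m h).2) h3
      refine ⟨b, Subtype.ext (funext fun h => ?_)⟩
      exact Prod.ext ((hb _).symm.trans (h2 h).symm) (hb h).symm
  rw [← Nat.card_congr (Equiv.ofBijective f hf), Nat.card_fun, Nat.card_eq_fintype_card,
    Fintype.card_fin]
  rfl

namespace OrientedTrivalentGraph

variable {V H : Type*} [Fintype V] [Fintype H] (G : OrientedTrivalentGraph V H)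

open Classical in
theorem stateSum_gl (K : Type*) [Field K] (N : ℕ) :
    stateSum G (glVertex K N) (glEdge K N) =
      ∑ ε : V → ℤˣ, (((∏ v, ε v : ℤˣ) : ℤ) : K) * (N : K) ^ G.numFaces (G.rot ε) := by
  let c : ℤˣ → Fin N × Fin N → Fin N × Fin N → Fin N × Fin N → K := fun σ p q r =>
    if σ = 1 then (if p.2 = q.1 then 1 else 0) * (if q.2 = r.1 then 1 else 0) *
      (if r.2 = p.1 then 1 else 0)
    else (if p.2 = r.1 then 1 else 0) * (if q.2 = p.1 then 1 else 0) *
      (if r.2 = q.1 then 1 else 0)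
  have h1 : ∀ p q r, glVertex K N p q r = ∑ σ : ℤˣ, ((σ : ℤ) : K) * c σ p q r := fun p q r => by
    rw [UnitsInt.univ, Finset.sum_pair (by decide)]
    simp only [c, glVertex, if_true, if_neg (show ¬ (-1 : ℤˣ) = 1 by decide)]
    push_cast
    ring
  have h2 : ∀ (ε : V → ℤˣ) (m : H → Fin N × Fin N), ∏ v, c (ε v) (m (G.halfAt v))
      (m (G.next (G.halfAt v))) (m (G.next (G.next (G.halfAt v)))) =
      ∏ h, if (m h).2 = (m (G.rot ε h)).1 then 1 else 0 := fun ε m => by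
    rw [G.isRotation_next.prod_half]
    refine Finset.prod_congr rfl fun v _ => ?_
    have hv := G.vert_halfAt v
    have hn := G.isRotation_next.vert_apply
    rcases Int.units_eq_one_or (ε v) with e | e
    · rw [rot_of_pos (by rw [hv, e]), rot_of_pos (by rw [hn, hv, e]),
        rot_of_pos (by rw [hn, hn, hv, e]), G.isRotation_next.apply_three]
      exact if_pos e
    · rw [rot_of_neg (by rw [hv, e]), rot_of_neg (by rw [hn, hv, e]),
        rot_of_neg (by rw [hn, hn, hv, e]), Equiv.symm_apply_apply, Equiv.symm_apply_apply,
        G.isRotation_next.symm_apply]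
      exact if_neg (by rw [e]; decide)
  have h3 : ∀ m : H → Fin N × Fin N, ∏ e : G.Edge, glEdge K N (m e.out) (m (G.flip e.out)) =
      ∏ h, if (m h).1 = (m (G.flip h)).2 then 1 else 0 := fun m => by
    rw [G.prod_half_edge]
    refine Finset.prod_congr rfl fun e _ => ?_
    rw [glEdge, G.flip_flip, mul_comm]
    congr 1
    simp only [eq_comm]
  have h4 : ∀ ε : V → ℤˣ, (∑ m : H → Fin N × Fin N,
      (∏ h, if (m h).2 = (m (G.rot ε h)).1 then 1 else 0) *
        ∏ h, if (m h).1 = (m (G.flip h)).2 then 1 else 0 : K) = (N : K) ^ G.numFaces (G.rot ε) :=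
      fun ε => by
    rw [← Nat.cast_pow, ← TrivalentGraph.IsRotation.card_labellings, Nat.card_eq_fintype_card,
      Fintype.card_subtype, ← Finset.sum_boole]
    refine Finset.sum_congr rfl fun m _ => ?_
    rw [Finset.prod_boole, Finset.prod_boole, ite_and]
    simp only [Finset.mem_univ, true_imp_iff, ite_mul, one_mul, zero_mul]
  unfold stateSum
  simp only [h1, Fintype.prod_sum, Finset.prod_mul_distrib, h2, h3, Finset.sum_mul]
  rw [Finset.sum_comm]
  refine Finset.sum_congr rfl fun ε _ => ?_
  rw [← h4, Finset.mul_sum]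
  refine Finset.sum_congr rfl fun m _ => ?_
  rw [mul_assoc]
  congr 1
  push_cast
  rfl

open Classical in
/-- The polynomial expressing the `sl(N)` weight: the signed sum over all choices of cyclic
orderings at the vertices of `X` to the number of faces. -/
noncomputable def slPolynomial : ℤ[X] :=
  ∑ ε : V → ℤˣ, Polynomial.C ((∏ v, ε v : ℤˣ) : ℤ) * Polynomial.X ^ G.numFaces (G.rot ε)

theorem isSlPolynomial_slPolynomial (K : Type*) [Field K] [CharZero K] :
    IsSlPolynomial K G G.slPolynomial := by
  intro N hN ι _ b
  rw [lieWeight_sl hN, stateSum_gl, slPolynomial, Polynomial.eval_finsetSum]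
  simp only [Polynomial.eval_mul, Polynomial.eval_C, Polynomial.eval_pow, Polynomial.eval_X,
    Int.cast_sum, Int.cast_mul, Int.cast_pow, Int.cast_natCast]

theorem eq_slPolynomial (K : Type*) [Field K] [CharZero K] {P : ℤ[X]}
    (hP : IsSlPolynomial K G P) : P = G.slPolynomial := by
  have h1 : ∀ N : ℕ, 1 ≤ N → P.eval (N : ℤ) = G.slPolynomial.eval (N : ℤ) := fun N hN => by
    have b := Module.finBasis K (LieAlgebra.SpecialLinear.sl (Fin N) K)
    exact_mod_cast (hP N hN _ b).symm.trans (G.isSlPolynomial_slPolynomial K N hN _ b)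
  refine Polynomial.eq_of_infinite_eval_eq _ _ (Set.Infinite.mono
    (s := Set.range fun n : ℕ => ((n + 1 : ℕ) : ℤ)) ?_ (Set.infinite_range_of_injective ?_))
  · rintro _ ⟨n, rfl⟩
    exact h1 _ (by omega)
  · intro m n e
    simpa using e

variable {G}

theorem natDegree_slPolynomial_le (hG : G.Connected) :
    G.slPolynomial.natDegree ≤ Fintype.card V / 2 + 2 := by
  refine Polynomial.natDegree_sum_le_of_forall_le _ _ fun ε _ => ?_
  exact (Polynomial.natDegree_C_mul_X_pow_le _ _).trans
    (TrivalentGraph.numFaces_le (isRotation_rot ε) hG)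

open Classical in
theorem coeff_slPolynomial (hG : G.Connected) :
    G.slPolynomial.coeff (Fintype.card V / 2 + 2) =
      ∑ ε ∈ Finset.univ.filter (fun ε : V → ℤˣ => G.Exact (G.rot ε)), ((∏ v, ε v : ℤˣ) : ℤ) := by
  rw [slPolynomial, Polynomial.finsetSum_coeff, Finset.sum_filter]
  refine Finset.sum_congr rfl fun ε _ => ?_
  rw [Polynomial.coeff_C_mul_X_pow]
  simp only [← TrivalentGraph.numFaces_eq_iff (isRotation_rot ε) hG, eq_comm]

open Classical in
theorem natAbs_coeff_slPolynomial (hG : G.TwoConnected) :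
    (G.slPolynomial.coeff (Fintype.card V / 2 + 2)).natAbs =
      (Finset.univ.filter (fun ε : V → ℤˣ => G.Exact (G.rot ε))).card := by
  rw [coeff_slPolynomial hG.1]
  rcases (Finset.univ.filter (fun ε : V → ℤˣ => G.Exact (G.rot ε))).eq_empty_or_nonempty with
    e | ⟨ε₀, h₀⟩
  · rw [e]
    rfl
  · rw [Finset.sum_congr rfl fun ε hε => by
      rw [prod_eq_prod_of_exact hG (Finset.mem_filter.1 hε).2 (Finset.mem_filter.1 h₀).2]]
    rw [Finset.sum_const, nsmul_eq_mul, Int.natAbs_mul, Int.natAbs_natCast, Int.units_natAbs,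
      mul_one]

end OrientedTrivalentGraph

theorem Equiv.Perm.SameCycle.of_semiconj {α β : Type*} {p : Equiv.Perm α} {q : Equiv.Perm β}
    {e : α → β} (h : ∀ x, e (p x) = q (e x)) {x y : α} (hxy : p.SameCycle x y) :
    q.SameCycle (e x) (e y) := by
  obtain ⟨n, rfl⟩ := hxy
  refine ⟨n, ?_⟩
  induction n with
  | zero => rfl
  | succ k ih => simp only [add_comm _ (1 : ℤ), zpow_add, zpow_one, Equiv.Perm.mul_apply, ih, h]
  | pred k ih =>
    simp only [sub_eq_add_neg, add_comm _ (-1 : ℤ), zpow_add, zpow_neg_one, Equiv.Perm.mul_apply,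
      ih]
    rw [Equiv.Perm.inv_eq_iff_eq, ← h, Equiv.Perm.coe_inv, Equiv.apply_symm_apply]

theorem Equiv.Perm.sameCycle_iff_of_semiconj {α β : Type*} {p : Equiv.Perm α} {q : Equiv.Perm β}
    (e : α ≃ β) (h : ∀ x, e (p x) = q (e x)) {x y : α} :
    q.SameCycle (e x) (e y) ↔ p.SameCycle x y := by
  refine ⟨fun H => ?_, Equiv.Perm.SameCycle.of_semiconj h⟩
  have := Equiv.Perm.SameCycle.of_semiconj (p := q) (q := p) (e := e.symm)
    (fun y => by rw [Equiv.symm_apply_eq, h, e.apply_symm_apply]) H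
  simpa using this

theorem PermCycles.card_congr {α β : Type*} {p : Equiv.Perm α} {q : Equiv.Perm β}
    (e : α ≃ β) (h : ∀ x, e (p x) = q (e x)) :
    Nat.card (PermCycles p) = Nat.card (PermCycles q) :=
  Nat.card_congr (Quotient.congr e fun _ _ => (Equiv.Perm.sameCycle_iff_of_semiconj e h).symm)

theorem TrivalentGraph.card_cycles_rotation {V H : Type*} {G : TrivalentGraph V H}
    {s : Equiv.Perm H} (hs : G.IsRotation s) : Nat.card (PermCycles s) = Nat.card V := by
  refine Nat.card_congr (Equiv.ofBijective (Quotient.lift G.vert fun h h' e => (hs h h').1 e)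
    ⟨?_, fun v => ⟨Quotient.mk _ (G.halfAt v), G.vert_halfAt v⟩⟩)
  intro x y e
  induction x using Quotient.inductionOn with | _ x
  induction y using Quotient.inductionOn with | _ y
  exact Quotient.sound ((hs x y).2 e)

namespace SphereEmbedding

variable {V H : Type*} {G : TrivalentGraph V H}

/-- The rotation system of an embedding. -/
def rotation (A : SphereEmbedding G) : Equiv.Perm H :=
  (A.side.trans A.surface.rot).trans A.side.symm

theorem side_rotation (A : SphereEmbedding G) (h : H) :
    A.side (A.rotation h) = A.surface.rot (A.side h) := by
  simp [rotation]

theorem isRotation_rotation (A : SphereEmbedding G) : G.IsRotation A.rotation := fun h h' => by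
  rw [← A.side_vert, Equiv.Perm.sameCycle_iff_of_semiconj A.side A.side_rotation]

theorem face_eq (A : SphereEmbedding G) (s : A.surface.Side) :
    A.surface.face s = A.surface.rot.symm (A.surface.opp s) := by
  rw [Equiv.eq_symm_apply]
  simp [OrientedCellSurface.rot]

theorem side_facePerm (A : SphereEmbedding G) (h : H) :
    A.side (G.facePerm A.rotation h) = A.surface.face (A.side h) := by
  rw [TrivalentGraph.facePerm_apply, face_eq, ← A.side_flip, Equiv.eq_symm_apply, ← side_rotation,
    Equiv.apply_symm_apply]

theorem setoid_iff (A A' : SphereEmbedding G) :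
    (SphereEmbedding.setoid G).r A A' ↔ A.rotation = A'.rotation := by
  constructor
  · rintro ⟨e, h1, h2, h3⟩
    have h4 : ∀ s, e (A.surface.rot s) = A'.surface.rot (e s) := fun s => by
      have h5 : e (A.surface.face⁻¹ s) = A'.surface.face⁻¹ (e s) := by
        rw [eq_comm, Equiv.Perm.inv_eq_iff_eq, ← h1]
        simp
      simp only [OrientedCellSurface.rot, Equiv.Perm.mul_apply, h2, h5]
    ext h
    apply A'.side.injective
    rw [← h3, side_rotation, side_rotation, h4, h3]
  · intro e
    refine ⟨A.side.symm.trans A'.side, fun s => ?_, fun s => ?_, fun h => by simp⟩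
    · obtain ⟨h, rfl⟩ := A.side.surjective s
      rw [← side_facePerm, e]
      simp [side_facePerm]
    · obtain ⟨h, rfl⟩ := A.side.surjective s
      rw [← A.side_flip]
      simp [A'.side_flip]

variable [Fintype V] [Fintype H]

theorem numFaces_rotation (A : SphereEmbedding G) :
    G.numFaces A.rotation = Fintype.card V / 2 + 2 := by
  have h1 := A.isSphere.2
  have h2 := A.isRotation_rotation.card_half
  have h3 := G.card_half_edge
  rw [OrientedCellSurface.eulerChar, ← PermCycles.card_congr A.side A.side_rotation,
    ← PermCycles.card_congr A.side A.side_flip, ← PermCycles.card_congr A.side A.side_facePerm,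
    TrivalentGraph.card_cycles_rotation A.isRotation_rotation, Nat.card_eq_fintype_card (α := V)]
    at h1
  change _ + ((G.numFaces A.rotation : ℕ) : ℤ) = 2 at h1
  change Fintype.card H = 2 * Nat.card (PermCycles G.flip) at h3
  omega

theorem exists_rotation_eq (hG : G.Connected) {s : Equiv.Perm H} (hs : G.IsRotation s)
    (hF : G.numFaces s = Fintype.card V / 2 + 2) : ∃ A : SphereEmbedding G, A.rotation = s := by
  let e : H ≃ Fin (Fintype.card H) := Fintype.equivFin H
  let S : OrientedCellSurface :=
    { Side := Fin (Fintype.card H)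
      finite := inferInstance
      face := (e.symm.trans (G.facePerm s)).trans e
      opp := (e.symm.trans G.flip).trans e
      opp_opp := fun x => by simp [G.flip_flip]
      opp_ne := fun x h => G.flip_ne (e.symm x) (e.injective (by simpa using h)) }
  have hopp : ∀ h, e (G.flip h) = S.opp (e h) := fun h => by simp [S]
  have hface : ∀ h, e (G.facePerm s h) = S.face (e h) := fun h => by simp [S]
  have hrot : ∀ h, e (s h) = S.rot (e h) := fun h => by
    have h1 : S.face⁻¹ (e h) = e (G.flip (s h)) := by
      rw [Equiv.Perm.inv_eq_iff_eq, ← hface, TrivalentGraph.facePerm_apply, G.flip_flip,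
        Equiv.symm_apply_apply]
    rw [OrientedCellSurface.rot, Equiv.Perm.mul_apply, h1, ← hopp, G.flip_flip]
  have hconn : S.Connected := by
    obtain ⟨v⟩ : Nonempty V := hG.nonempty
    refine ⟨⟨e (G.halfAt v)⟩, ?_⟩
    let Γ := Subgroup.closure {S.face, S.opp}
    have mface : S.face ∈ Γ := Subgroup.subset_closure (Or.inl rfl)
    have mopp : S.opp ∈ Γ := Subgroup.subset_closure (Or.inr rfl)
    have mrot : S.rot ∈ Γ := mul_mem mopp (inv_mem mface)
    let R : S.Side → S.Side → Prop := fun x y => ∃ g ∈ Γ, g x = y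
    have Rtrans : ∀ {x y z}, R x y → R y z → R x z := by
      rintro x _ _ ⟨g, hg, rfl⟩ ⟨g', hg', rfl⟩
      exact ⟨g' * g, mul_mem hg' hg, rfl⟩
    have Rsymm : ∀ {x y}, R x y → R y x := by
      rintro x _ ⟨g, hg, rfl⟩
      exact ⟨g⁻¹, inv_mem hg, by simp⟩
    have R1 : ∀ h, R (e h) (e (s h)) := fun h => ⟨S.rot, mrot, (hrot h).symm⟩
    have R2 : ∀ h, R (e h) (e (G.flip h)) := fun h => ⟨S.opp, mopp, (hopp h).symm⟩
    have R3 : ∀ h h', G.vert h' = G.vert h → R (e h) (e h') := fun h h' hv => by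
      rcases hs.vert_eq_iff.1 hv with rfl | rfl | rfl
      · exact ⟨1, one_mem _, rfl⟩
      · exact R1 _
      · exact Rtrans (R1 _) (R1 _)
    have R4 := TrivalentGraph.eq_of_connected hG
      (fun w => R (e (G.halfAt v)) (e (G.halfAt w))) fun h _ _ => by
        have R5 : R (e (G.halfAt (G.vert h))) (e (G.halfAt (G.vert (G.flip h)))) :=
          Rtrans (R3 _ h (G.vert_halfAt _).symm) (Rtrans (R2 h) (R3 _ _ (G.vert_halfAt _)))
        exact propext ⟨fun r => Rtrans r R5, fun r => Rtrans r (Rsymm R5)⟩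
    have R6 : ∀ h, R (e (G.halfAt v)) (e h) := fun h =>
      Rtrans ((R4 v (G.vert h)).mp (R3 _ _ rfl)) (R3 _ _ (G.vert_halfAt _).symm)
    intro x y
    obtain ⟨h, rfl⟩ := e.surjective x
    obtain ⟨h', rfl⟩ := e.surjective y
    exact Rtrans (Rsymm (R6 h)) (R6 h')
  have heuler : S.eulerChar = 2 := by
    have h2 := hs.card_half
    have h3 := G.card_half_edge
    rw [OrientedCellSurface.eulerChar, ← PermCycles.card_congr e hrot,
      ← PermCycles.card_congr e hopp, ← PermCycles.card_congr e hface,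
      TrivalentGraph.card_cycles_rotation hs, Nat.card_eq_fintype_card (α := V)]
    change _ + ((G.numFaces s : ℕ) : ℤ) = 2
    change Fintype.card H = 2 * Nat.card (PermCycles G.flip) at h3
    omega
  let A : SphereEmbedding G := ⟨S, ⟨hconn, heuler⟩, e, hopp, fun h h' => by
    rw [Equiv.Perm.sameCycle_iff_of_semiconj e hrot, hs]⟩
  refine ⟨A, ?_⟩
  ext h
  apply e.injective
  rw [hrot]
  exact A.side_rotation h

end SphereEmbedding

open Classical in
theorem OrientedTrivalentGraph.card_sphereEmbeddings {V H : Type*} [Fintype V] [Fintype H]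
    {G : OrientedTrivalentGraph V H} (hG : G.Connected) :
    ENat.card (SphereEmbeddings G.toTrivalentGraph) =
      ((Finset.univ.filter (fun ε : V → ℤˣ => G.Exact (G.rot ε))).card : ℕ∞) := by
  let f : SphereEmbeddings G.toTrivalentGraph →
      {s : Equiv.Perm H // ∃ ε, G.Exact (G.rot ε) ∧ G.rot ε = s} :=
    Quotient.lift (fun A => ⟨A.rotation, by
      obtain ⟨ε, hε⟩ := exists_rot_eq A.isRotation_rotation
      refine ⟨ε, ?_, hε⟩
      rw [← TrivalentGraph.numFaces_eq_iff (isRotation_rot ε) hG, hε, A.numFaces_rotation]⟩)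
      fun A A' h => Subtype.ext ((SphereEmbedding.setoid_iff A A').1 h)
  have hf : Function.Bijective f := by
    constructor
    · intro x y h
      induction x using Quotient.inductionOn with | _ x
      induction y using Quotient.inductionOn with | _ y
      exact Quotient.sound ((SphereEmbedding.setoid_iff x y).2 (congrArg Subtype.val h))
    · rintro ⟨_, ε, hε, rfl⟩
      obtain ⟨A, hA⟩ := SphereEmbedding.exists_rotation_eq hG (isRotation_rot ε)
        ((TrivalentGraph.numFaces_eq_iff (isRotation_rot ε) hG).2 hε)
      exact ⟨Quotient.mk _ A, Subtype.ext hA⟩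
  let g : {ε : V → ℤˣ // G.Exact (G.rot ε)} →
      {s : Equiv.Perm H // ∃ ε, G.Exact (G.rot ε) ∧ G.rot ε = s} :=
    fun ε => ⟨G.rot ε.1, ε.1, ε.2, rfl⟩
  have hg : Function.Bijective g :=
    ⟨fun ε ε' h => Subtype.ext (rot_injective (congrArg Subtype.val h)),
      fun ⟨_, ε, hε, h⟩ => ⟨⟨ε, hε⟩, Subtype.ext h⟩⟩
  rw [ENat.card_congr ((Equiv.ofBijective f hf).trans (Equiv.ofBijective g hg).symm),
    ENat.card_eq_coe_fintype_card, Fintype.card_subtype]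

theorem proposition1p3 (K : Type*) [Field K] [CharZero K] {V H : Type*} [Fintype V] [Fintype H]
    (G : OrientedTrivalentGraph V H) (hG : G.Connected) :
    (∃! P : ℤ[X], IsSlPolynomial K G P) ∧
    ∀ P : ℤ[X], IsSlPolynomial K G P →
      P.natDegree ≤ Fintype.card V / 2 + 2 ∧
      (G.TwoConnected →
        ENat.card (SphereEmbeddings G.toTrivalentGraph) =
          ((P.coeff (Fintype.card V / 2 + 2)).natAbs : ℕ∞)) ∧
      (¬ G.TwoConnected → P.coeff (Fintype.card V / 2 + 2) = 0) := by
  refine ⟨⟨_, G.isSlPolynomial_slPolynomial K, fun _ => G.eq_slPolynomial K⟩, fun P hP => ?_⟩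
  rw [G.eq_slPolynomial K hP]
  refine ⟨OrientedTrivalentGraph.natDegree_slPolynomial_le hG, fun h => ?_, fun h => ?_⟩
  · rw [OrientedTrivalentGraph.natAbs_coeff_slPolynomial h,
      OrientedTrivalentGraph.card_sphereEmbeddings hG]
  · rw [OrientedTrivalentGraph.coeff_slPolynomial hG,
      OrientedTrivalentGraph.sum_prod_exact_eq_zero hG h]
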